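/- All graphs are finite and simple. For a vertex $v$ of a graph $G$, $G\setminus v$ is the graph obtained by deleting $v$, and the local complementation $G*v$ is obtained from $G$ by toggling the adjacency of every pair of distinct neighbors of $v$. Two graphs are locally equivalent if one can be obtained from the other by a sequence of local complementations. For an edge $vw$ let $G\wedge vw := G*v*w*v$. Let $G/v$ denote $G\setminus v$ if $v$ has no neighbor, and otherwise $(G\wedge vw)\setminus v$ for an arbitrary neighbor $w$ of $v$ (whether $G/v$ is prime does not depend on the choice of $w$). A split of $G$ is a partition $(A,B)$ of $V(G)$ with $|A|,|B|\ge 2$ such that for some $A'\subseteq A$ and $B'\subseteq B$, two vertices $x\in A$ and $y\in B$ are adjacent if and only if $x\in A'$ and $y\in B'$; $G$ is prime if it has no split. A vertex $v$ is non-pivotal if $G\setminus v$ or $G/v$ is prime. Every prime graph with at least $5$ vertices has at least $2$ non-pivotal vertices, unless it is locally equivalent to a cycle graph. -/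

import Mathlib

namespace SimpleGraph

variable {V : Type*}

/-- The local complementation `G * v`: the adjacency between two distinct neighbours of `v` is
toggled, all other adjacencies are kept. -/
def localCompl (G : SimpleGraph V) (v : V) : SimpleGraph V where
  Adj x y := x ≠ y ∧ Xor (G.Adj x y) (G.Adj v x ∧ G.Adj v y)
  symm := ⟨fun x y h => ⟨h.1.symm, by
    have h2 := h.2
    rwa [G.adj_comm x y, and_comm (a := G.Adj v x)] at h2⟩⟩
  loopless := ⟨fun _ h => h.1 rfl⟩

/-- `H` is obtained from `G` by a (possibly empty) finite sequence of local complementations. -/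
def LocallyEquivalent (G H : SimpleGraph V) : Prop :=
  Relation.ReflTransGen (fun G₁ G₂ : SimpleGraph V => ∃ v, G₂ = G₁.localCompl v) G H

/-- `G` is locally equivalent to a cycle graph on its vertex set. -/
def LocallyEquivalentToCycle (G : SimpleGraph V) : Prop :=
  ∃ H : SimpleGraph V, G.LocallyEquivalent H ∧ ∃ n : ℕ, 3 ≤ n ∧ Nonempty (H ≃g cycleGraph n)

/-- The pivoting `G ∧ vw = G * v * w * v` (used for edges `vw`). -/
def pivoting (G : SimpleGraph V) (v w : V) : SimpleGraph V :=
  ((G.localCompl v).localCompl w).localCompl v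

/-- The vertex deletion `G \ v`. -/
def deleteVertex (G : SimpleGraph V) (v : V) : SimpleGraph {u : V // u ≠ v} :=
  G.comap Subtype.val

/-- `(A, B)` is a split of `G`: a partition of the vertex set into two parts with at least two
vertices each, whose crossing edges are exactly the pairs in `A' × B'` for some `A' ⊆ A`,
`B' ⊆ B`. -/
def IsSplit (G : SimpleGraph V) (A B : Set V) : Prop :=
  A ∪ B = Set.univ ∧ Disjoint A B ∧ A.Nontrivial ∧ B.Nontrivial ∧
    ∃ A' ⊆ A, ∃ B' ⊆ B, ∀ x ∈ A, ∀ y ∈ B, G.Adj x y ↔ x ∈ A' ∧ y ∈ B'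

/-- A graph is prime if it has no split. -/
def IsPrimeGraph (G : SimpleGraph V) : Prop :=
  ¬ ∃ A B : Set V, G.IsSplit A B

/-- `H` is a version of `G / v`: it is `G \ v` if `v` has no neighbour, and otherwise
`(G ∧ vw) \ v` for some choice of a neighbour `w` of `v`. -/
def IsContraction (G : SimpleGraph V) (v : V) (H : SimpleGraph {u : V // u ≠ v}) : Prop :=
  ((∀ w, ¬ G.Adj v w) ∧ H = G.deleteVertex v) ∨
    ∃ w, G.Adj v w ∧ H = (G.pivoting v w).deleteVertex v

/-- A version of `G / v` always exists. -/
theorem exists_isContraction (G : SimpleGraph V) (v : V) : ∃ H, G.IsContraction v H := by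
  by_cases h : ∀ w, ¬ G.Adj v w
  · exact ⟨_, Or.inl ⟨h, rfl⟩⟩
  · push Not at h
    obtain ⟨w, hw⟩ := h
    exact ⟨_, Or.inr ⟨w, hw, rfl⟩⟩

/-- `v` is non-pivotal if `G \ v` is prime or `G / v` is prime. The graph `G / v` depends on an
arbitrary choice of a neighbour of `v`; primeness is required for every choice. -/
def NonPivotal (G : SimpleGraph V) (v : V) : Prop :=
  (G.deleteVertex v).IsPrimeGraph ∨ ∀ H, G.IsContraction v H → H.IsPrimeGraph

end SimpleGraph

set_option linter.unusedSectionVars false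

/-! ### Letters and their alternating form -/

namespace PauliCode

open Module

/-! The proof passes from graphs to isotropic systems. The `code` of `G` consists of the words `V →
Letter` whose second components are the adjacency matrix applied to the first; it equals its own
orthogonal complement (`code_isSelfDual`). For a vertex set `Z`, `|Z|` minus the dimension of the
words supported on `Z` is the cut-rank of `Z`, so primeness of `G` yields `IsPrime`: cut-rank at
least 2 when both sides have at least two elements. Local complementation acts on words letter by
letter, preserving the form. Hence a split of `G \ v` or of `G / v` becomes a split of the minor of
the code at `v` with respect to `(0, 1)` or `(1, 0)`, and a vertex that is not non-pivotal has two
distinct `Bad` letters; such an element is called essential.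

It remains to show that a prime self-dual code of length at least 5 with at most one inessential
element is cyclic, in the manner of Tutte's Wheels Theorem. Uncrossing two bad splits at one element
gives a word of weight three through it (`exists_trip_of_bad`); uncrossing splits at two elements of
such a word gives a second word of weight three sharing exactly two elements with it
(`triangle_lemma`). These words overlap in chains. In a longest chain the triangle lemma at an end
produces a word that would prolong the chain, contradict isotropy, or close it up (`IsChain.cyclic`,
`IsChain.closing`).

In a cyclic code the words on consecutive triples form a fundamental basis whose graph is a cycle,
and every fundamental graph of the code is locally equivalent to `G`
(`IsFundamental.locallyEquivalent`). -/

/-- The Klein four-group, as a two-dimensional space over the field with two elements. -/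
abbrev Letter := ZMod 2 × ZMod 2

/-- The nondegenerate alternating form on `Letter`. -/
def pr (a b : Letter) : ZMod 2 := a.1 * b.2 + a.2 * b.1

theorem pr_add_right (a b c : Letter) : pr a (b + c) = pr a b + pr a c := by
  simp only [pr, Prod.fst_add, Prod.snd_add]; ring

theorem pr_add_left (a b c : Letter) : pr (a + b) c = pr a c + pr b c := by
  simp only [pr, Prod.fst_add, Prod.snd_add]; ring

theorem pr_smul_right (r : ZMod 2) (a b : Letter) : pr a (r • b) = r * pr a b := by
  simp only [pr, Prod.smul_fst, Prod.smul_snd, smul_eq_mul]; ring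

theorem pr_smul_left (r : ZMod 2) (a b : Letter) : pr (r • a) b = r * pr a b := by
  simp only [pr, Prod.smul_fst, Prod.smul_snd, smul_eq_mul]; ring

@[simp] theorem pr_zero_right (a : Letter) : pr a 0 = 0 := by simp [pr]

@[simp] theorem pr_zero_left (a : Letter) : pr 0 a = 0 := by simp [pr]

@[simp] theorem pr_self (a : Letter) : pr a a = 0 := by revert a; decide

theorem pr_comm (a b : Letter) : pr a b = pr b a := by simp only [pr]; ring

theorem pr_eq_zero {a b : Letter} (ha : a ≠ 0) : pr a b = 0 ↔ b = 0 ∨ b = a := by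
  revert a b; decide

theorem eq_of_pr {a b : Letter} (ha : a ≠ 0) (hb : b ≠ 0) (h : pr a b = 0) : a = b := by
  revert a b; decide

theorem pr_eq_one_iff {a b : Letter} : pr a b = 1 ↔ a ≠ 0 ∧ b ≠ 0 ∧ a ≠ b := by
  revert a b; decide

theorem pr_ne_zero_iff {a b : Letter} : pr a b ≠ 0 ↔ pr a b = 1 := by
  revert a b; decide

theorem add_self_letter (a : Letter) : a + a = 0 := by revert a; decide

theorem add_eq_zero_letter {a b : Letter} : a + b = 0 ↔ a = b := by revert a b; decide

/-! ### Self-dual codes, primeness and minors -/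

section Codes

variable {V : Type*}

/-- The words vanishing outside `Z`. -/
def supp (Z : Finset V) : Submodule (ZMod 2) (V → Letter) where
  carrier := {c | ∀ u, u ∉ Z → c u = 0}
  add_mem' := fun ha hb u hu => by simp [ha u hu, hb u hu]
  zero_mem' := fun _ _ => rfl
  smul_mem' := fun r c hc u hu => by simp [hc u hu]

theorem supp_mono {Y Z : Finset V} (h : Y ⊆ Z) : supp Y ≤ supp Z :=
  fun _ hc u hu => hc u fun hY => hu (h hY)

/-- The words whose letter at `a` is `0` or `α` (for `α ≠ 0`). -/
def letterAt (a : V) (α : Letter) : Submodule (ZMod 2) (V → Letter) where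
  carrier := {c | pr α (c a) = 0}
  add_mem' := fun {x y} ha hb => by
    simp only [Set.mem_ofPred_eq] at *
    rw [Pi.add_apply, pr_add_right, ha, hb, add_zero]
  zero_mem' := by simp
  smul_mem' := fun r c hc => by
    simp only [Set.mem_ofPred_eq] at *
    rw [Pi.smul_apply, pr_smul_right, hc, mul_zero]

theorem mem_letterAt {a : V} {α : Letter} {c : V → Letter} :
    c ∈ letterAt a α ↔ pr α (c a) = 0 := Iff.rfl

variable [Fintype V]

/-- The standard alternating form on words. -/
def form (V : Type*) [Fintype V] : LinearMap.BilinForm (ZMod 2) (V → Letter) :=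
  LinearMap.mk₂ (ZMod 2) (fun c d => ∑ v, pr (c v) (d v))
    (fun a b c => by simp [pr_add_left, Finset.sum_add_distrib])
    (fun r a b => by simp [pr_smul_left, Finset.mul_sum])
    (fun a b c => by simp [pr_add_right, Finset.sum_add_distrib])
    (fun r a b => by simp [pr_smul_right, Finset.mul_sum])

theorem form_apply (c d : V → Letter) : form V c d = ∑ v, pr (c v) (d v) := rfl

theorem form_comm (c d : V → Letter) : form V c d = form V d c := by
  simp only [form_apply]; exact Finset.sum_congr rfl fun _ _ => pr_comm _ _

theorem form_eq_sum {c d : V → Letter} (s : Finset V) (h : ∀ u, u ∉ s → c u = 0 ∨ d u = 0) :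
    form V c d = ∑ v ∈ s, pr (c v) (d v) := by
  rw [form_apply]
  symm
  apply Finset.sum_subset (Finset.subset_univ _)
  intro u _ hu
  rcases h u hu with h | h <;> simp [h]

variable [DecidableEq V]

theorem form_single (v : V) (α : Letter) (d : V → Letter) :
    form V (Pi.single v α) d = pr α (d v) := by
  rw [form_eq_sum {v}]
  · simp
  · intro u hu
    left
    exact Pi.single_eq_of_ne (by simpa using hu) _

theorem form_nondegenerate : (form V).Nondegenerate := by
  have key : ∀ c : V → Letter, (∀ d, form V d c = 0) → c = 0 := by
    intro c hc
    funext v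
    have h1 := hc (Pi.single v (1, 0))
    have h2 := hc (Pi.single v (0, 1))
    rw [form_single] at h1 h2
    simp only [pr] at h1 h2
    ext
    · simpa using h2
    · simpa using h1
  refine ⟨fun c hc => key c fun d => ?_, fun c hc => key c hc⟩
  rw [form_comm]; exact hc d

/-- Codes that coincide with their dual with respect to `form`. -/
def IsSelfDual (L : Submodule (ZMod 2) (V → Letter)) : Prop := (form V).orthogonal L = L

theorem IsSelfDual.form_eq_zero {L : Submodule (ZMod 2) (V → Letter)} (hL : IsSelfDual L)
    {c d : V → Letter} (hc : c ∈ L) (hd : d ∈ L) : form V c d = 0 := by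
  have : d ∈ (form V).orthogonal L := by rw [hL]; exact hd
  exact LinearMap.BilinForm.mem_orthogonal_iff.1 this c hc

theorem finrank_words : finrank (ZMod 2) (V → Letter) = 2 * Fintype.card V := by
  rw [Module.finrank_pi_fintype]
  simp [mul_comm]

theorem IsSelfDual.finrank_eq {L : Submodule (ZMod 2) (V → Letter)} (hL : IsSelfDual L) :
    finrank (ZMod 2) L = Fintype.card V := by
  have h := LinearMap.BilinForm.finrank_orthogonal (form_nondegenerate (V := V)) L
  have h2 := Submodule.finrank_le L
  rw [hL, finrank_words] at h
  rw [finrank_words] at h2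
  omega

/-- The code counterpart of having no split. -/
def IsPrime (L : Submodule (ZMod 2) (V → Letter)) : Prop :=
  ∀ Z : Finset V, 2 ≤ Z.card → 2 ≤ Zᶜ.card → finrank (ZMod 2) ↥(L ⊓ supp Z) + 2 ≤ Z.card

/-- The minor of `L` at `a` with respect to the letter `α` has a split. -/
def Bad (L : Submodule (ZMod 2) (V → Letter)) (a : V) (α : Letter) : Prop :=
  ∃ X Y : Finset V, Disjoint X Y ∧ X ∪ Y = {a}ᶜ ∧ 2 ≤ X.card ∧ 2 ≤ Y.card ∧
    X.card ≤ finrank (ZMod 2) ↥(L ⊓ supp (insert a X) ⊓ letterAt a α) + 1 ∧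
    Y.card ≤ finrank (ZMod 2) ↥(L ⊓ supp (insert a Y) ⊓ letterAt a α) + 1

variable {L : Submodule (ZMod 2) (V → Letter)}

theorem exists_ne_zero_of_finrank {N : Submodule (ZMod 2) (V → Letter)}
    (h : 1 ≤ finrank (ZMod 2) N) : ∃ c ∈ N, c ≠ 0 := by
  by_contra hcon
  push Not at hcon
  rw [(Submodule.eq_bot_iff N).2 hcon] at h
  simp at h

theorem finrank_add_one_le {N M : Submodule (ZMod 2) (V → Letter)} {t : V → Letter}
    (h : N ≤ M) (ht : t ∈ M) (htN : t ∉ N) : finrank (ZMod 2) N + 1 ≤ finrank (ZMod 2) M :=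
  Submodule.finrank_lt_finrank_of_lt (lt_of_le_of_ne h fun e => htN (e ▸ ht))

/-- Every nonzero word of a prime code has at least three nonzero letters. -/
theorem IsPrime.eq_zero (hP : IsPrime L) (hn : 4 ≤ Fintype.card V) {c : V → Letter} (hc : c ∈ L)
    {Z : Finset V} (hZ : Z.card ≤ 2) (hcZ : c ∈ supp Z) : c = 0 := by
  -- Primeness says nothing about sets with fewer than two elements, so `Z` is first enlarged to
  -- size exactly 2.
  obtain ⟨Y, hZY, hY⟩ := Finset.exists_superset_card_eq (n := 2) hZ (by omega)
  have h := hP Y (by omega) (by rw [Finset.card_compl]; omega)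
  by_contra hne
  have := finrank_add_one_le (N := ⊥) (M := L ⊓ supp Y) bot_le ⟨hc, supp_mono hZY hcZ⟩ (by simpa)
  rw [finrank_bot] at this
  omega

/-- `L` has a word whose nonzero letters are precisely those at `a`, `b`, `c`. -/
def Trip (L : Submodule (ZMod 2) (V → Letter)) (a b c : V) : Prop :=
  ∃ t ∈ L, ∀ u, t u ≠ 0 ↔ u = a ∨ u = b ∨ u = c

theorem mem_supp_pair {a b c : V} {t : V → Letter} (ht : t ∈ supp {a, b, c}) (h : t a = 0) :
    t ∈ supp {b, c} := by
  intro u hu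
  by_cases hua : u = a
  · rw [hua, h]
  · exact ht u (by simp at hu ⊢; tauto)

theorem IsPrime.ne_zero_iff (hP : IsPrime L) (hn : 4 ≤ Fintype.card V) {t : V → Letter} (ht : t ∈ L)
    (h0 : t ≠ 0) {a b c : V} (hs : t ∈ supp {a, b, c}) (u : V) :
    t u ≠ 0 ↔ u = a ∨ u = b ∨ u = c := by
  have key : ∀ a b c : V, t ∈ supp {a, b, c} → t a ≠ 0 := fun a b c hs h =>
    h0 (hP.eq_zero hn ht Finset.card_le_two (mem_supp_pair hs h))
  constructor
  · intro hu
    by_contra hcon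
    exact hu (hs u (by simpa using hcon))
  · rintro (rfl | rfl | rfl)
    · exact key _ b c hs
    · exact key _ a c (by rwa [Finset.insert_comm])
    · refine key _ a b ?_
      exact supp_mono (by intro x; simp; tauto) hs

theorem IsPrime.trip (hP : IsPrime L) (hn : 4 ≤ Fintype.card V) {t : V → Letter} (ht : t ∈ L)
    (h0 : t ≠ 0) {a b c : V} (hs : t ∈ supp {a, b, c}) : Trip L a b c :=
  ⟨t, ht, hP.ne_zero_iff hn ht h0 hs⟩

theorem IsPrime.trip_of_finrank (hP : IsPrime L) (hn : 4 ≤ Fintype.card V) {a b c : V}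
    {N : Submodule (ZMod 2) (V → Letter)} (hN : N ≤ L ⊓ supp {a, b, c})
    (h : 1 ≤ finrank (ZMod 2) N) : Trip L a b c := by
  obtain ⟨t, ht, h0⟩ := exists_ne_zero_of_finrank h
  exact hP.trip hn (hN ht).1 h0 (hN ht).2

theorem Trip.perm {a b c a' b' c' : V} (h : Trip L a b c)
    (hp : ∀ u, (u = a ∨ u = b ∨ u = c) ↔ (u = a' ∨ u = b' ∨ u = c')) : Trip L a' b' c' := by
  obtain ⟨t, ht, h⟩ := h
  exact ⟨t, ht, fun u => (h u).trans (hp u)⟩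

/-! ### Uncrossing splits of minors -/

/-- The submodular inequality for dimensions. -/
theorem finrank_uncross {N₁ N₂ M₁ M₂ : Submodule (ZMod 2) (V → Letter)}
    (h₁ : N₁ ⊓ N₂ ≤ M₁) (h₂ : N₁ ⊔ N₂ ≤ M₂) :
    finrank (ZMod 2) N₁ + finrank (ZMod 2) N₂ ≤ finrank (ZMod 2) M₁ + finrank (ZMod 2) M₂ := by
  have := Submodule.finrank_sup_add_finrank_inf_eq N₁ N₂
  have := Submodule.finrank_mono h₁
  have := Submodule.finrank_mono h₂
  omega

theorem finrank_uncross_add_one {N₁ N₂ M₁ M₂ : Submodule (ZMod 2) (V → Letter)} {t : V → Letter}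
    (h₁ : N₁ ⊓ N₂ ≤ M₁) (h₂ : N₁ ⊔ N₂ ≤ M₂) (ht : t ∈ M₂) (htN : t ∉ N₁ ⊔ N₂) :
    finrank (ZMod 2) N₁ + finrank (ZMod 2) N₂ + 1 ≤
      finrank (ZMod 2) M₁ + finrank (ZMod 2) M₂ := by
  have := Submodule.finrank_sup_add_finrank_inf_eq N₁ N₂
  have := Submodule.finrank_mono h₁
  have := finrank_add_one_le h₂ ht htN
  omega

/-- Isotropy leaves a single summand when two words of `L` overlap in one element; two nonzero
letters there must then coincide, by `eq_of_pr`. -/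
theorem IsSelfDual.pr_eq_zero (hL : IsSelfDual L) {c d : V → Letter} (hc : c ∈ L) (hd : d ∈ L)
    {p : V} (h : ∀ u, u ≠ p → c u = 0 ∨ d u = 0) : pr (c p) (d p) = 0 := by
  have := hL.form_eq_zero hc hd
  rwa [form_eq_sum {p} (fun u hu => h u (by simpa using hu)), Finset.sum_singleton] at this

theorem IsSelfDual.pr_eq_pr (hL : IsSelfDual L) {c d : V → Letter} (hc : c ∈ L) (hd : d ∈ L)
    {p q : V} (hpq : p ≠ q) (h : ∀ u, u ≠ p → u ≠ q → c u = 0 ∨ d u = 0) :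
    pr (c p) (d p) = pr (c q) (d q) := by
  have := hL.form_eq_zero hc hd
  rw [form_eq_sum {p, q} (fun u hu => by simp at hu; exact h u hu.1 hu.2),
    Finset.sum_pair hpq] at this
  exact CharTwo.add_eq_zero.1 this

theorem eq_zero_of_pr {α β γ : Letter} : pr α β = 1 → pr α γ = 0 → pr β γ = 0 → γ = 0 := by
  revert α β γ; decide

/-- One side of a split of the minor of `L` at `a` with respect to `α`. -/
def HalfBad (L : Submodule (ZMod 2) (V → Letter)) (a : V) (α : Letter) (X : Finset V) : Prop :=
  X.card ≤ finrank (ZMod 2) ↥(L ⊓ supp (insert a X) ⊓ letterAt a α) + 1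

theorem bad_iff {a : V} {α : Letter} : Bad L a α ↔
    ∃ X Y : Finset V, Disjoint X Y ∧ X ∪ Y = {a}ᶜ ∧ 2 ≤ X.card ∧ 2 ≤ Y.card ∧
      HalfBad L a α X ∧ HalfBad L a α Y := Iff.rfl

theorem HalfBad.trip (hP : IsPrime L) (hn : 4 ≤ Fintype.card V) {a p q : V} {α : Letter}
    (h : HalfBad L a α {p, q}) (hpq : p ≠ q) : Trip L a p q := by
  unfold HalfBad at h
  rw [Finset.card_pair hpq] at h
  refine hP.trip_of_finrank hn (N := L ⊓ supp {a, p, q} ⊓ letterAt a α) inf_le_left ?_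
  omega

theorem HalfBad.exists_trip (hP : IsPrime L) (hn : 4 ≤ Fintype.card V) {a : V} {α : Letter}
    {X : Finset V} (h : HalfBad L a α X) (haX : a ∉ X) (hX : X.card = 2) :
    ∃ b c, b ≠ a ∧ c ≠ a ∧ b ≠ c ∧ Trip L a b c := by
  obtain ⟨p, q, hpq, rfl⟩ := Finset.card_eq_two.1 hX
  simp only [Finset.mem_insert, Finset.mem_singleton, not_or] at haX
  exact ⟨p, q, Ne.symm haX.1, Ne.symm haX.2, hpq, h.trip hP hn hpq⟩

/-- A word counted for both `X` and `X'` has at `v` a letter orthogonal to both `α` and `β`, hence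
`0`, so it is supported on `X ∩ X'`. Submodularity would give `|X| + |X'| - 2` as a lower bound for
the two dimensions, while primeness bounds them above by `|X| + |X'| - 3`. -/
theorem HalfBad.card_le_one (hP : IsPrime L) {v : V} {α β : Letter} (hαβ : pr α β = 1)
    {X X' : Finset V} (h : HalfBad L v α X) (h' : HalfBad L v β X') (hv : v ∉ X) (hv' : v ∉ X') :
    (X ∩ X').card ≤ 1 ∨ (insert v (X ∪ X'))ᶜ.card ≤ 1 := by
  by_contra hcon
  push Not at hcon
  obtain ⟨h1, h2⟩ := hcon
  have hcard := Finset.card_union_add_card_inter X X'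
  have hvu : v ∉ X ∪ X' := by simp [hv, hv']
  have hins := Finset.card_insert_of_notMem hvu
  have p1 := hP (X ∩ X') h1 (h2.trans_le (Finset.card_le_card (Finset.compl_subset_compl.2
    (fun u hu => Finset.mem_insert_of_mem (Finset.mem_union_left _ (Finset.mem_inter.1 hu).1)))))
  have p2 := hP (insert v (X ∪ X')) (by
    have := Finset.card_le_card (Finset.inter_subset_union (s := X) (t := X')); omega) h2
  unfold HalfBad at h h'
  have key := finrank_uncross (N₁ := L ⊓ supp (insert v X) ⊓ letterAt v α)
    (N₂ := L ⊓ supp (insert v X') ⊓ letterAt v β) (M₁ := L ⊓ supp (X ∩ X'))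
    (M₂ := L ⊓ supp (insert v (X ∪ X'))) (by
      rintro c ⟨⟨⟨hc, hs⟩, ha⟩, ⟨⟨-, hs'⟩, hb⟩⟩
      refine ⟨hc, fun u hu => ?_⟩
      by_cases huv : u = v
      · subst huv
        have ha : pr α (c u) = 0 := ha
        have hb : pr β (c u) = 0 := hb
        exact eq_zero_of_pr hαβ ha hb
      · simp only [Finset.mem_inter, not_and_or] at hu
        rcases hu with hu | hu
        · exact hs u (by simp [huv, hu])
        · exact hs' u (by simp [huv, hu])) (by
      refine sup_le ?_ ?_
      · rintro c ⟨⟨hc, hs⟩, -⟩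
        exact ⟨hc, supp_mono (Finset.insert_subset_insert _ Finset.subset_union_left) hs⟩
      · rintro c ⟨⟨hc, hs⟩, -⟩
        exact ⟨hc, supp_mono (Finset.insert_subset_insert _ Finset.subset_union_right) hs⟩)
  omega

/-- The two parts of a partition of the complement of `a`. -/
theorem mem_of_partition {a : V} {X Y : Finset V} (h : X ∪ Y = {a}ᶜ) :
    (∀ u, u ∈ X ∨ u ∈ Y ↔ u ≠ a) := fun u => by
  rw [← Finset.mem_union, h]; simp

theorem card_erase_of_partition {b : V} {X Y : Finset V} (hd : ∀ ⦃u⦄, u ∈ X → u ∉ Y)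
    (h : X ∪ Y = {b}ᶜ) (A : Finset V) :
    (A.erase b).card = (A ∩ X).card + (A ∩ Y).card := by
  rw [← Finset.card_union_of_disjoint]
  · congr 1
    rw [← Finset.inter_union_distrib_left, h, Finset.erase_eq, Finset.sdiff_eq_inter_compl]
  · rw [Finset.disjoint_left]; intro u; have := @hd u; simp only [Finset.mem_inter]; tauto

/-- An element at which two minors have a split lies in the support of a word of weight three. -/
theorem exists_trip_of_bad (hP : IsPrime L) (hn : 4 ≤ Fintype.card V) {v : V} {α β : Letter}
    (hαβ : pr α β = 1) (h : Bad L v α) (h' : Bad L v β) :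
    ∃ b c, b ≠ v ∧ c ≠ v ∧ b ≠ c ∧ Trip L v b c := by
  obtain ⟨X, Y, hd, hu, hX, hY, hbX, hbY⟩ := bad_iff.1 h
  obtain ⟨X', Y', hd', hu', hX', hY', hbX', hbY'⟩ := bad_iff.1 h'
  have m := mem_of_partition hu
  have m' := mem_of_partition hu'
  rw [Finset.disjoint_left] at hd hd'
  have vX : v ∉ X := fun h => (m v).1 (Or.inl h) rfl
  have vY : v ∉ Y := fun h => (m v).1 (Or.inr h) rfl
  have vX' : v ∉ X' := fun h => (m' v).1 (Or.inl h) rfl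
  have vY' : v ∉ Y' := fun h => (m' v).1 (Or.inr h) rfl
  have c1 := hbX.card_le_one hP hαβ hbX' vX vX'
  have c2 := hbX.card_le_one hP hαβ hbY' vX vY'
  have e1 : (insert v (X ∪ X'))ᶜ = Y ∩ Y' := by
    ext u; have := m u; have := m' u; have := @hd u; have := @hd' u
    simp only [Finset.mem_compl, Finset.mem_insert, Finset.mem_union, Finset.mem_inter]; grind
  have e2 : (insert v (X ∪ Y'))ᶜ = Y ∩ X' := by
    ext u; have := m u; have := m' u; have := @hd u; have := @hd' u
    simp only [Finset.mem_compl, Finset.mem_insert, Finset.mem_union, Finset.mem_inter]; grind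
  rw [e1] at c1
  rw [e2] at c2
  have k1 := card_erase_of_partition hd' hu' X
  have k2 := card_erase_of_partition hd' hu' Y
  have k3 := card_erase_of_partition hd hu X'
  have k4 := card_erase_of_partition hd hu Y'
  rw [Finset.erase_eq_of_notMem ‹_›, Finset.inter_comm _ X, Finset.inter_comm _ Y] at k3 k4
  rw [Finset.erase_eq_of_notMem ‹_›] at k1 k2
  -- In each diagonal pair of the four corners one corner has at most one element. Two such corners,
  -- one from each pair, make up a side of one of the splits, which therefore has exactly two
  -- elements.
  have : X.card = 2 ∨ Y.card = 2 ∨ X'.card = 2 ∨ Y'.card = 2 := by omega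
  rcases this with h | h | h | h
  · exact hbX.exists_trip hP hn vX h
  · exact hbY.exists_trip hP hn vY h
  · exact hbX'.exists_trip hP hn vX' h
  · exact hbY'.exists_trip hP hn vY' h

/-- A word of `L` with letter not in `{0, α}` at `a` cannot be supported by one side of a split of
the corresponding minor. -/
theorem HalfBad.not_mem_supp (hP : IsPrime L) {a : V} {α : Letter} {X : Finset V}
    (h : HalfBad L a α X) (ha : a ∉ X) (hX : 2 ≤ X.card) (hc : 2 ≤ (insert a X)ᶜ.card)
    {t : V → Letter} (ht : t ∈ L) (hta : pr α (t a) = 1) : t ∉ supp (insert a X) := by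
  intro hs
  have hins := Finset.card_insert_of_notMem ha
  have p := hP (insert a X) (by omega) hc
  -- The word `t` adds a dimension to those counted by `HalfBad`, giving at least `|X|`, whereas
  -- primeness of `insert a X` allows only `|X| - 1`.
  have := finrank_add_one_le (N := L ⊓ supp (insert a X) ⊓ letterAt a α)
    (M := L ⊓ supp (insert a X)) inf_le_left ⟨ht, hs⟩ (fun h => by
      have h2 : pr α (t a) = 0 := h.2
      rw [hta] at h2
      exact one_ne_zero h2)
  unfold HalfBad at h
  omega

/-- Uncrossing of sides of splits of minors at two different elements of a word of weight three. -/
theorem HalfBad.uncross (hP : IsPrime L) {a b : V} {α β : Letter} {X Y : Finset V}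
    (h : HalfBad L a α X) (h' : HalfBad L b β Y) (ha : a ∉ X) (hb : b ∉ Y)
    (hab : a ∉ insert b Y ∨ b ∉ insert a X) {t : V → Letter} (ht : t ∈ L)
    (hta : pr α (t a) = 1) (htb : pr β (t b) = 1) (hs : t ∈ supp (insert a X ∪ insert b Y)) :
    (insert a X ∩ insert b Y).card ≤ 1 ∨ (insert a X ∪ insert b Y)ᶜ.card ≤ 1 := by
  by_contra hcon
  push Not at hcon
  obtain ⟨h1, h2⟩ := hcon
  have hcard := Finset.card_union_add_card_inter (insert a X) (insert b Y)
  have hins := Finset.card_insert_of_notMem ha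
  have hins' := Finset.card_insert_of_notMem hb
  have hsub := Finset.inter_subset_union (s := insert a X) (t := insert b Y)
  have p1 := hP _ h1 (h2.trans_le (Finset.card_le_card (Finset.compl_subset_compl.2 hsub)))
  have p2 := hP _ (h1.trans_le (Finset.card_le_card hsub)) h2
  unfold HalfBad at h h'
  -- The word `t` lies in the space on the union but not in the sum of the two spaces: `hab` makes
  -- its letter at `a` or at `b` come from one summand alone, where that letter is excluded. This
  -- extra dimension exceeds what primeness permits.
  have key := finrank_uncross_add_one (N₁ := L ⊓ supp (insert a X) ⊓ letterAt a α)
    (N₂ := L ⊓ supp (insert b Y) ⊓ letterAt b β) (M₁ := L ⊓ supp (insert a X ∩ insert b Y))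
    (M₂ := L ⊓ supp (insert a X ∪ insert b Y)) (t := t) (by
      rintro c ⟨⟨⟨hc, hs⟩, -⟩, ⟨⟨-, hs'⟩, -⟩⟩
      refine ⟨hc, fun u hu => ?_⟩
      rw [Finset.mem_inter, not_and_or] at hu
      exact hu.elim (hs u) (hs' u)) (by
      refine sup_le ?_ ?_
      · rintro c ⟨⟨hc, hs⟩, -⟩
        exact ⟨hc, supp_mono Finset.subset_union_left hs⟩
      · rintro c ⟨⟨hc, hs⟩, -⟩
        exact ⟨hc, supp_mono Finset.subset_union_right hs⟩) ⟨ht, hs⟩ (by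
      intro hmem
      obtain ⟨x, ⟨⟨-, hx⟩, hxa⟩, y, ⟨⟨-, hy⟩, hyb⟩, rfl⟩ := Submodule.mem_sup.1 hmem
      have hxa : pr α (x a) = 0 := hxa
      have hyb : pr β (y b) = 0 := hyb
      rcases hab with hab | hab
      · rw [Pi.add_apply, hy a hab, add_zero, hxa] at hta
        exact zero_ne_one hta
      · rw [Pi.add_apply, hx b hab, zero_add, hyb] at htb
        exact zero_ne_one htb)
  omega

/-! ### The triangle lemma -/

/-- The configuration left over by uncrossing in the triangle lemma. -/
theorem trip_of_halfBad (hL : IsSelfDual L) (hP : IsPrime L) {a b c p q r : V}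
    {α β : Letter} (hn : 6 ≤ Fintype.card V) (hd : [a, b, c, p, q, r].Nodup)
    (h : HalfBad L a α {p, q, b}) (h' : HalfBad L b β {p, r, a})
    {t : V → Letter} (ht : t ∈ L) (hts : ∀ u, t u ≠ 0 ↔ u = a ∨ u = b ∨ u = c)
    (hta : pr α (t a) = 1) (htb : pr β (t b) = 1) : Trip L a b p := by
  simp only [List.nodup_cons, List.mem_cons, List.not_mem_nil, or_false, not_or,
    not_false_eq_true, List.nodup_nil, and_true] at hd
  obtain ⟨⟨ab, ac, ap, aq, ar⟩, ⟨bc, bp, bq, br⟩, ⟨cp, cq, cr⟩, ⟨pq, pr'⟩, qr⟩ := hd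
  have tz : ∀ u, u ≠ a → u ≠ b → u ≠ c → t u = 0 := fun u h1 h2 h3 => by
    by_contra h; rcases (hts u).1 h with h | h | h <;> contradiction
  have hn4 : 4 ≤ Fintype.card V := by omega
  -- a word and its partner in the minor at an element
  have key : ∀ (a b p q : V) (α : Letter), a ≠ b → a ≠ p → a ≠ q → p ≠ q → p ≠ b → q ≠ b →
      α ≠ 0 → HalfBad L a α {p, q, b} → ∃ v ∈ L, v ∈ supp {a, p, q, b} ∧ v a = α ∧
      ∃ w ∈ L, w ∈ supp {p, q, b} ∧ w ≠ 0 := by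
    intro a b p q α ab ap aq pq pb qb hα h
    have hc : ({p, q, b} : Finset V).card = 3 := Finset.card_eq_three.2 ⟨p, q, b, pq, pb, qb, rfl⟩
    have h' : ({p, q, b} : Finset V).card ≤ _ := h
    rw [hc] at h'
    have hp := hP {p, q, b} (by omega) (by rw [Finset.card_compl]; omega)
    set N := L ⊓ supp (insert a {p, q, b}) ⊓ letterAt a α with hN
    have letter : ∀ v ∈ N, v a = 0 ∨ v a = α := fun v hv => (PauliCode.pr_eq_zero hα).1 hv.2
    have mem0 : ∀ v ∈ N, v a = 0 → v ∈ L ⊓ supp {p, q, b} := fun v hv h0 => by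
      refine ⟨hv.1.1, fun u hu => ?_⟩
      by_cases hua : u = a
      · rw [hua, h0]
      · exact hv.1.2 u (by rw [Finset.mem_insert]; tauto)
    -- `N` has dimension at least 2, but primeness allows only dimension 1 for the words supported
    -- on `{p, q, b}`; so some word of `N` is nonzero at `a`.
    obtain ⟨v, hv, hva1⟩ : ∃ v ∈ N, v a ≠ 0 := by
      by_contra hcon
      push Not at hcon
      have := Submodule.finrank_mono (show N ≤ L ⊓ supp {p, q, b} from
        fun v hv => mem0 v hv (hcon v hv))
      omega
    have hva : v a = α := (letter v hv).resolve_left hva1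
    obtain ⟨w, hw, hwv⟩ : ∃ w ∈ N, w ∉ Submodule.span (ZMod 2) {v} := by
      by_contra hcon
      push Not at hcon
      have := Submodule.finrank_mono (show N ≤ Submodule.span (ZMod 2) {v} from hcon)
      have := finrank_span_singleton (K := ZMod 2) (v := v) (fun h => hva1 (by rw [h]; rfl))
      omega
    refine ⟨v, hv.1.1, hv.1.2, hva, ?_⟩
    have hw0 : w ≠ 0 := fun h => hwv (h ▸ Submodule.zero_mem _)
    have hwv1 : w + v ≠ 0 := fun h => hwv (by
      have : w = v := by
        funext u; exact add_eq_zero_letter.1 (congrFun h u)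
      rw [this]; exact Submodule.mem_span_singleton_self v)
    rcases letter w hw with hwa | hwa
    · exact ⟨w, (mem0 w hw hwa).1, (mem0 w hw hwa).2, hw0⟩
    · have := mem0 (w + v) (N.add_mem hw hv) (by rw [Pi.add_apply, hwa, hva, add_self_letter])
      exact ⟨w + v, this.1, this.2, hwv1⟩
  have hα : α ≠ 0 := by rintro rfl; simp at hta
  have hβ : β ≠ 0 := by rintro rfl; simp at htb
  obtain ⟨v, hv, hvs, hva, w, hw, hws, hw0⟩ := key a b p q α ab ap aq pq (Ne.symm bp) (Ne.symm bq)
    hα h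
  obtain ⟨-, -, -, -, w', hw', hws', hw0'⟩ := key b a p r β (Ne.symm ab) bp br pr' (Ne.symm ap)
    (Ne.symm ar) hβ h'
  have hwi := hP.ne_zero_iff hn4 hw hw0 hws
  have hwi' := hP.ne_zero_iff hn4 hw' hw0' hws'
  have wz : ∀ u, u ≠ p → u ≠ q → u ≠ b → w u = 0 := fun u h1 h2 h3 => hws u (by simp [h1, h2, h3])
  have wz' : ∀ u, u ≠ p → u ≠ r → u ≠ a → w' u = 0 := fun u h1 h2 h3 => hws' u (by simp [h1, h2, h3])
  have vz : ∀ u, u ≠ a → u ≠ p → u ≠ q → u ≠ b → v u = 0 := fun u h1 h2 h3 h4 =>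
    hvs u (by simp [h1, h2, h3, h4])
  have wb : t b = w b := by
    refine eq_of_pr ((hts b).2 (by simp)) ((hwi b).2 (by simp)) (hL.pr_eq_zero ht hw fun u hu => ?_)
    by_cases hua : u = a
    · right; exact hua ▸ wz a ap aq ab
    by_cases huc : u = c
    · right; exact huc ▸ wz c cp cq (Ne.symm bc)
    · left; exact tz u hua hu huc
  have wa : t a = w' a := by
    refine eq_of_pr ((hts a).2 (by simp)) ((hwi' a).2 (by simp))
      (hL.pr_eq_zero ht hw' fun u hu => ?_)
    by_cases hub : u = b
    · right; exact hub ▸ wz' b bp br (Ne.symm ab)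
    by_cases huc : u = c
    · right; exact huc ▸ wz' c cp cr (Ne.symm ac)
    · left; exact tz u hu hub huc
  have wp : w p = w' p := by
    refine eq_of_pr ((hwi p).2 (by simp)) ((hwi' p).2 (by simp))
      (hL.pr_eq_zero hw hw' fun u hu => ?_)
    by_cases huq : u = q
    · right; exact huq ▸ wz' q (Ne.symm pq) qr (Ne.symm aq)
    by_cases hub : u = b
    · right; exact hub ▸ wz' b bp br (Ne.symm ab)
    · left; exact wz u hu huq hub
  have vb : pr (v a) (t a) = pr (v b) (t b) := by
    refine hL.pr_eq_pr hv ht ab fun u h1 h2 => ?_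
    by_cases huc : u = c
    · left; exact huc ▸ vz c (Ne.symm ac) cp cq (Ne.symm bc)
    · right; exact tz u h1 h2 huc
  have vp : pr (v a) (w' a) = pr (v p) (w' p) := by
    refine hL.pr_eq_pr hv hw' ap fun u h1 h2 => ?_
    by_cases hur : u = r
    · left; exact hur ▸ vz r (Ne.symm ar) (Ne.symm pr') (Ne.symm qr) (Ne.symm br)
    · right; exact wz' u h2 hur h1
  -- The contributions at `b` and `p` to the form of `v` and `w` both equal `pr α (t a) = 1`,
  -- transported through `t` and `w'`. They cancel, so the contribution at `q` vanishes: `v` or `v +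
  -- w` is zero at `q` and has support `{a, b, p}`.
  have vw := hL.form_eq_zero hv hw
  rw [form_eq_sum {b, p, q} (fun u hu => by
    simp only [Finset.mem_insert, Finset.mem_singleton, not_or] at hu
    right; exact wz u hu.2.1 hu.2.2 hu.1), Finset.sum_insert (by simp [bp, bq]),
    Finset.sum_pair pq, ← wb, wp, ← vb, ← vp, ← wa, hva, hta, ← add_assoc,
    CharTwo.add_self_eq_zero, zero_add] at vw
  have hq := PauliCode.pr_eq_zero (b := v q) ((hwi q).2 (by simp))
  rw [pr_comm, vw] at hq
  rcases hq.1 rfl with hq | hq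
  · refine hP.trip hn4 hv (fun h => hα (by rw [← hva, h]; rfl)) fun u hu => ?_
    simp only [Finset.mem_insert, Finset.mem_singleton, not_or] at hu
    by_cases huq : u = q
    · rw [huq, hq]
    · exact vz u hu.1 hu.2.2 huq hu.2.1
  · have wa0 := wz a ap aq ab
    refine hP.trip hn4 (L.add_mem hv hw) (fun h => hα ?_) fun u hu => ?_
    · have := congrFun h a
      rwa [Pi.add_apply, wa0, add_zero, hva] at this
    · simp only [Finset.mem_insert, Finset.mem_singleton, not_or] at hu
      by_cases huq : u = q
      · rw [huq, Pi.add_apply, hq, add_self_letter]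
      · rw [Pi.add_apply, vz u hu.1 hu.2.2 huq hu.2.1, wz u hu.2.2 huq hu.2.1, add_zero]

theorem insert_pair_rotate (x y z : V) : insert x ({y} ∪ {z} : Finset V) = {y, z, x} := by
  ext u; simp only [Finset.mem_insert, Finset.mem_union, Finset.mem_singleton]; tauto

theorem compl_insert_union {a b : V} {X Y X' Y' : Finset V} (hd : ∀ ⦃u⦄, u ∈ X → u ∉ Y)
    (hd' : ∀ ⦃u⦄, u ∈ X' → u ∉ Y') (h : X ∪ Y = {a}ᶜ) (h' : X' ∪ Y' = {b}ᶜ) :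
    (insert a Y ∪ insert b Y')ᶜ = X ∩ X' := by
  ext u
  have := mem_of_partition h u
  have := mem_of_partition h' u
  have := @hd u
  have := @hd' u
  simp only [Finset.mem_compl, Finset.mem_insert, Finset.mem_union, Finset.mem_inter]
  tauto

set_option maxHeartbeats 400000 in
/-- The analogue of Tutte's triangle lemma. -/
theorem triangle_lemma (hL : IsSelfDual L) (hP : IsPrime L) (hn : 6 ≤ Fintype.card V)
    {a b c : V} (ab : a ≠ b) (ac : a ≠ c) (bc : b ≠ c) {t : V → Letter} (ht : t ∈ L)
    (hts : ∀ u, t u ≠ 0 ↔ u = a ∨ u = b ∨ u = c) {α β : Letter}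
    (hta : pr α (t a) = 1) (htb : pr β (t b) = 1) (ha : Bad L a α) (hb : Bad L b β) :
    ∃ d, d ≠ a ∧ d ≠ b ∧ d ≠ c ∧ (Trip L a b d ∨ Trip L a c d) := by
  have hn4 : 4 ≤ Fintype.card V := by omega
  -- a split of the minor at `x` separates the other two elements of the support
  have sep : ∀ (x y z : V) (γ : Letter), y ≠ x → z ≠ x → (∀ u, t u ≠ 0 ↔ u = x ∨ u = y ∨ u = z) →
      pr γ (t x) = 1 → Bad L x γ → ∃ X Y : Finset V, Disjoint X Y ∧ X ∪ Y = {x}ᶜ ∧ 2 ≤ X.card ∧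
        2 ≤ Y.card ∧ HalfBad L x γ X ∧ HalfBad L x γ Y ∧ y ∈ X ∧ z ∈ Y := by
    intro x y z γ yx zx hts hγ hbad
    obtain ⟨X, Y, hd, hu, hX, hY, hbX, hbY⟩ := bad_iff.1 hbad
    have m := mem_of_partition hu
    have hd' := Finset.disjoint_left.1 hd
    have xX : x ∉ X := fun h => (m x).1 (Or.inl h) rfl
    have xY : x ∉ Y := fun h => (m x).1 (Or.inr h) rfl
    have e1 : (insert x X)ᶜ = Y := by
      ext u; have := m u; have := @hd' u
      simp only [Finset.mem_compl, Finset.mem_insert]; grind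
    have e2 : (insert x Y)ᶜ = X := by
      ext u; have := m u; have := @hd' u
      simp only [Finset.mem_compl, Finset.mem_insert]; grind
    have n1 := hbX.not_mem_supp hP xX hX (by rwa [e1]) ht hγ
    have n2 := hbY.not_mem_supp hP xY hY (by rwa [e2]) ht hγ
    have insupp : ∀ W : Finset V, y ∈ W → z ∈ W → t ∈ supp (insert x W) := by
      intro W h1 h2 u hu
      rw [Finset.mem_insert, not_or] at hu
      by_contra h
      rcases (hts u).1 h with rfl | rfl | rfl
      · exact hu.1 rfl
      · exact hu.2 h1
      · exact hu.2 h2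
    rcases (m y).2 yx with hy | hy <;> rcases (m z).2 zx with hz | hz
    · exact absurd (insupp X hy hz) n1
    · exact ⟨X, Y, hd, hu, hX, hY, hbX, hbY, hy, hz⟩
    · exact ⟨Y, X, hd.symm, by rw [Finset.union_comm, hu], hY, hX, hbY, hbX, hy, hz⟩
    · exact absurd (insupp Y hy hz) n2
  obtain ⟨X, Y, hd, hu, hX, hY, hbX, hbY, bX, cY⟩ := sep a b c α (Ne.symm ab) (Ne.symm ac) hts hta ha
  obtain ⟨X', Y', hd', hu', hX', hY', hbX', hbY', aX', cY'⟩ := sep b a c β ab (Ne.symm bc)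
    (fun u => (hts u).trans (by tauto)) htb hb
  have m := mem_of_partition hu
  have m' := mem_of_partition hu'
  rw [Finset.disjoint_left] at hd hd'
  have aX : a ∉ X := fun h => (m a).1 (Or.inl h) rfl
  have aY : a ∉ Y := fun h => (m a).1 (Or.inr h) rfl
  have bX' : b ∉ X' := fun h => (m' b).1 (Or.inl h) rfl
  have bY' : b ∉ Y' := fun h => (m' b).1 (Or.inr h) rfl
  have bY : b ∉ Y := hd bX
  have cX : c ∉ X := fun h => hd h cY
  have aY' : a ∉ Y' := hd' aX'
  have cX' : c ∉ X' := fun h => hd' h cY'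
  by_contra hcon
  push Not at hcon
  -- the sides are large
  have small : ∀ (x y : V) (γ : Letter) (W : Finset V), HalfBad L x γ W → y ∈ W → W.card = 2 →
      ∃ d ∈ W, d ≠ y ∧ Trip L x y d := by
    intro x y γ W hW hy hc
    obtain ⟨d, hd, hdy⟩ := Finset.exists_mem_ne (s := W) (by omega) y
    have : W = {y, d} := by
      symm
      apply Finset.eq_of_subset_of_card_le
      · intro u hu
        simp only [Finset.mem_insert, Finset.mem_singleton] at hu
        rcases hu with rfl | rfl <;> assumption
      · rw [Finset.card_pair (Ne.symm hdy), hc]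
    exact ⟨d, hd, hdy, (this ▸ hW).trip hP hn4 (Ne.symm hdy)⟩
  have kX : X.card ≠ 2 := fun h => by
    obtain ⟨d, hd, hdy, hT⟩ := small a b α X hbX bX h
    exact (hcon d (fun e => aX (e ▸ hd)) hdy (fun e => cX (e ▸ hd))).1 hT
  have kY : Y.card ≠ 2 := fun h => by
    obtain ⟨d, hd, hdy, hT⟩ := small a c α Y hbY cY h
    exact (hcon d (fun e => aY (e ▸ hd)) (fun e => bY (e ▸ hd)) hdy).2 hT
  have kX' : X'.card ≠ 2 := fun h => by
    obtain ⟨d, hd, hdy, hT⟩ := small b a β X' hbX' aX' h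
    exact (hcon d hdy (fun e => bX' (e ▸ hd)) (fun e => cX' (e ▸ hd))).1
      (hT.perm fun u => by tauto)
  -- uncrossing
  have tsupp : ∀ A B : Finset V, c ∈ insert a A ∪ insert b B →
      t ∈ supp (insert a A ∪ insert b B) := by
    intro A B h u hu
    by_contra h0
    rcases (hts u).1 h0 with rfl | rfl | rfl
    · simp at hu
    · simp at hu
    · exact hu h
  have u1 := hbY.uncross hP hbY' aY bY' (Or.inl (by simp [ab, aY'])) ht hta htb
    (tsupp _ _ (by simp [cY]))
  have u2 := hbY.uncross hP hbX' aY bX' (Or.inr (by simp [Ne.symm ab, bY])) ht hta htb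
    (tsupp _ _ (by simp [cY]))
  have u3 := hbX.uncross hP hbY' aX bY' (Or.inl (by simp [ab, aY'])) ht hta htb
    (tsupp _ _ (by simp [cY']))
  have e1 : insert a Y ∩ insert b Y' = Y ∩ Y' := by
    rw [Finset.insert_inter_of_notMem (by simp [ab, aY']), Finset.inter_insert_of_notMem bY]
  have e2 : insert a Y ∩ insert b X' = insert a (Y ∩ X') := by
    rw [Finset.insert_inter_of_mem (by simp [aX']), Finset.inter_insert_of_notMem bY]
  have e3 : insert a X ∩ insert b Y' = insert b (X ∩ Y') := by
    rw [Finset.insert_inter_of_notMem (by simp [ab, aY']), Finset.inter_insert_of_mem bX]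
  have hs : Y ∪ X = {a}ᶜ := by rw [Finset.union_comm, hu]
  have hs' : Y' ∪ X' = {b}ᶜ := by rw [Finset.union_comm, hu']
  have hds : ∀ ⦃u⦄, u ∈ Y → u ∉ X := fun u h h' => hd h' h
  have hds' : ∀ ⦃u⦄, u ∈ Y' → u ∉ X' := fun u h h' => hd' h' h
  have e1' := compl_insert_union hd hd' hu hu'
  have e2' := compl_insert_union hd hds' hu hs'
  have e3' := compl_insert_union hds hd' hs hu'
  rw [e1, e1'] at u1
  rw [e2, e2', Finset.card_insert_of_notMem (by simp [aY])] at u2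
  rw [e3, e3', Finset.card_insert_of_notMem (by simp [bY'])] at u3
  have k1 := card_erase_of_partition hd' hu' X
  have k2 := card_erase_of_partition hd' hu' Y
  have k3 := card_erase_of_partition hd hu X'
  have k4 := card_erase_of_partition hd hu Y'
  rw [Finset.card_erase_of_mem bX] at k1
  rw [Finset.erase_eq_of_notMem bY] at k2
  rw [Finset.card_erase_of_mem aX', Finset.inter_comm X' X, Finset.inter_comm X' Y] at k3
  rw [Finset.erase_eq_of_notMem aY', Finset.inter_comm Y' X, Finset.inter_comm Y' Y] at k4
  have k5 : 1 ≤ (Y ∩ Y').card := Finset.card_pos.2 ⟨c, by simp [cY, cY']⟩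
  -- Since `Y ∩ Y'` contains `c` and sides of size 2 are ruled out, the three uncrossing
  -- alternatives leave only these corner sizes.
  have hfin : (X ∩ X').card = 1 ∧ (X ∩ Y').card = 1 ∧ (Y ∩ X').card = 1 := by omega
  obtain ⟨⟨p, hp⟩, ⟨q, hq⟩, ⟨r, hr⟩⟩ := And.imp Finset.card_eq_one.1
    (And.imp Finset.card_eq_one.1 Finset.card_eq_one.1) hfin
  have hp' : p ∈ X ∩ X' := by simp [hp]
  have hq' : q ∈ X ∩ Y' := by simp [hq]
  have hr' : r ∈ Y ∩ X' := by simp [hr]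
  rw [Finset.mem_inter] at hp' hq' hr'
  have eX : X = {p, q, b} := by
    rw [← Finset.insert_erase bX, Finset.erase_eq, Finset.sdiff_eq_inter_compl, ← hu',
      Finset.inter_union_distrib_left, hp, hq,
      insert_pair_rotate]
  have eX' : X' = {p, r, a} := by
    rw [← Finset.insert_erase aX', Finset.erase_eq, Finset.sdiff_eq_inter_compl, ← hu,
      Finset.inter_union_distrib_left, Finset.inter_comm X' X, Finset.inter_comm X' Y, hp, hr,
      insert_pair_rotate]
  have pa : p ≠ a := fun h => aX (h ▸ hp'.1)
  have pb : p ≠ b := fun h => bX' (h ▸ hp'.2)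
  have pc : p ≠ c := fun h => cX (h ▸ hp'.1)
  refine (hcon p pa pb pc).1 (trip_of_halfBad hL hP (c := c) (q := q) (r := r) hn ?_
    (eX ▸ hbX) (eX' ▸ hbX') ht hts hta htb)
  have qa : q ≠ a := fun h => aX (h ▸ hq'.1)
  have qb : q ≠ b := fun h => bY' (h ▸ hq'.2)
  have qc : q ≠ c := fun h => cX (h ▸ hq'.1)
  have ra : r ≠ a := fun h => aY (h ▸ hr'.1)
  have rb : r ≠ b := fun h => bY (h ▸ hr'.1)
  have rc : r ≠ c := fun h => cX' (h ▸ hr'.2)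
  have pq : p ≠ q := fun h => hd' hp'.2 (h ▸ hq'.2)
  have pr' : p ≠ r := fun h => hd hp'.1 (h ▸ hr'.1)
  have qr : q ≠ r := fun h => hd hq'.1 (h ▸ hr'.1)
  simp only [List.nodup_cons, List.mem_cons, List.not_mem_nil, or_false, not_or,
    not_false_eq_true, List.nodup_nil, and_true]
  exact ⟨⟨ab, ac, pa.symm, qa.symm, ra.symm⟩, ⟨bc, pb.symm, qb.symm, rb.symm⟩,
    ⟨pc.symm, qc.symm, rc.symm⟩, ⟨pq, pr'⟩, qr⟩

/-! ### Extending words across an orthogonal complement -/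

/-- `N` is orthogonal to `L`, `W` and `g`, so the span of all three has dimension at most `2n - dim
N ≤ n + dim W`, with `n = |V|`. As `L` and `W` meet trivially, `L ⊔ W` already has dimension `n +
dim W`, so adding `g` enlarges nothing. -/
theorem IsSelfDual.mem_sup_of_orthogonal (hL : IsSelfDual L)
    {N W : Submodule (ZMod 2) (V → Letter)} (hLW : L ⊓ W = ⊥) (hNL : N ≤ L)
    (hNW : ∀ w ∈ W, ∀ c ∈ N, form V w c = 0) {g : V → Letter} (hg : ∀ c ∈ N, form V g c = 0)
    (h : Fintype.card V ≤ finrank (ZMod 2) N + finrank (ZMod 2) W) : g ∈ L ⊔ W := by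
  set M := L ⊔ W ⊔ Submodule.span (ZMod 2) {g} with hM
  have hN : N ≤ (form V).orthogonal M := by
    intro c hc
    rw [LinearMap.BilinForm.mem_orthogonal_iff]
    intro m hm
    obtain ⟨y, hy, s, hs, rfl⟩ := Submodule.mem_sup.1 hm
    obtain ⟨l, hl, w, hw, rfl⟩ := Submodule.mem_sup.1 hy
    obtain ⟨r, rfl⟩ := Submodule.mem_span_singleton.1 hs
    simp [hL.form_eq_zero hl (hNL hc), hNW w hw c hc, hg c hc]
  have h1 := Submodule.finrank_mono hN
  rw [LinearMap.BilinForm.finrank_orthogonal form_nondegenerate, finrank_words] at h1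
  have h2 := Submodule.finrank_le M
  rw [finrank_words] at h2
  have h3 := Submodule.finrank_sup_add_finrank_inf_eq L W
  rw [hLW, finrank_bot, hL.finrank_eq] at h3
  have h4 : L ⊔ W = M := Submodule.eq_of_le_of_finrank_le le_sup_left (by omega)
  rw [h4]
  exact Submodule.mem_sup_right (Submodule.mem_span_singleton_self g)

theorem finrank_supp_insert_add_one {N : Submodule (ZMod 2) (V → Letter)} {z : V} {Z : Finset V}
    (hz : z ∉ Z) {t : V → Letter} (ht : t ∈ N) (hs : t ∈ supp (insert z Z)) (h0 : t z ≠ 0) :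
    finrank (ZMod 2) ↥(N ⊓ supp Z) + 1 ≤ finrank (ZMod 2) ↥(N ⊓ supp (insert z Z)) :=
  finrank_add_one_le (inf_le_inf_left _ (supp_mono (Finset.subset_insert _ _))) ⟨ht, hs⟩
    fun h => h0 (h.2 z hz)

theorem finrank_supp_insert_add_two {N : Submodule (ZMod 2) (V → Letter)} {z : V} {Z : Finset V}
    (hz : z ∉ Z) {t t' : V → Letter} (ht : t ∈ N) (ht' : t' ∈ N) (hs : t ∈ supp (insert z Z))
    (hs' : t' ∈ supp (insert z Z)) (h0 : pr (t z) (t' z) = 1) :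
    finrank (ZMod 2) ↥(N ⊓ supp Z) + 2 ≤ finrank (ZMod 2) ↥(N ⊓ supp (insert z Z)) := by
  have h1 : finrank (ZMod 2) ↥(N ⊓ supp Z) + 1 ≤
      finrank (ZMod 2) ↥(N ⊓ supp (insert z Z) ⊓ letterAt z (t z)) := by
    refine finrank_add_one_le (t := t) ?_ ⟨⟨ht, hs⟩, pr_self _⟩ ?_
    · rintro c ⟨hc, hcs⟩
      refine ⟨⟨hc, supp_mono (Finset.subset_insert _ _) hcs⟩, ?_⟩
      rw [SetLike.mem_coe, mem_letterAt, hcs z hz, pr_zero_right]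
    · intro h
      exact (pr_eq_one_iff.1 h0).1 (h.2 z hz)
  have h2 := finrank_add_one_le (N := N ⊓ supp (insert z Z) ⊓ letterAt z (t z))
    (M := N ⊓ supp (insert z Z)) (t := t') inf_le_left ⟨ht', hs'⟩ (fun h => by
      have h3 : pr (t z) (t' z) = 0 := h.2
      rw [h0] at h3
      exact one_ne_zero h3)
  omega

theorem two_le_finrank_supp_singleton (z : V) : 2 ≤ finrank (ZMod 2) ↥(supp ({z} : Finset V)) := by
  have hs : ∀ α : Letter, Pi.single z α ∈ supp (insert z ∅ : Finset V) := fun α u hu => by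
    simp only [Finset.mem_insert, Finset.notMem_empty, or_false] at hu
    exact Pi.single_eq_of_ne hu _
  have := finrank_supp_insert_add_two (N := ⊤) (Finset.notMem_empty z) trivial trivial
    (hs (1, 0)) (hs (0, 1)) (by simp [pr])
  rw [top_inf_eq, top_inf_eq, insert_empty_eq] at this
  omega

/-- A word orthogonal to sufficiently many words vanishing at `w` extends to `L` across `w`. -/
theorem IsSelfDual.exists_extension (hL : IsSelfDual L) (hP : IsPrime L)
    (hn : 4 ≤ Fintype.card V) {w : V} {N : Submodule (ZMod 2) (V → Letter)} (hNL : N ≤ L)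
    (hNw : ∀ c ∈ N, c w = 0) {g : V → Letter} (hg : ∀ c ∈ N, form V g c = 0)
    (h : Fintype.card V ≤ finrank (ZMod 2) N + 2) : ∃ y ∈ L, ∀ u, u ≠ w → y u = g u := by
  have := two_le_finrank_supp_singleton w
  have hmem := hL.mem_sup_of_orthogonal (W := supp {w}) (N := N) (g := g) ((Submodule.eq_bot_iff _).2
    fun c hc => hP.eq_zero hn hc.1 (by simp) hc.2) hNL (fun c hc d hd => by
      rw [form_eq_sum {w} fun u hu => Or.inl (hc u hu)]
      simp [hNw d hd]) hg (by omega)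
  obtain ⟨y, hy, c, hc, rfl⟩ := Submodule.mem_sup.1 hmem
  exact ⟨y, hy, fun u hu => by rw [Pi.add_apply, hc u (by simpa using hu), add_zero]⟩

/-- A word orthogonal to a hyperplane of words in `L` with letters `0` and `z` at `p` belongs to
`L` up to a change of its letter at `p`. -/
theorem IsSelfDual.exists_correction (hL : IsSelfDual L) (hP : IsPrime L)
    (hn : 4 ≤ Fintype.card V) {p : V} {z : Letter} (hz : z ≠ 0)
    {N : Submodule (ZMod 2) (V → Letter)} (hNL : N ≤ L) (hNp : ∀ c ∈ N, pr z (c p) = 0)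
    {g : V → Letter} (hg : ∀ c ∈ N, form V g c = 0)
    (h : Fintype.card V ≤ finrank (ZMod 2) N + 1) :
    ∃ y ∈ L, (∀ u, u ≠ p → y u = g u) ∧ (y p = g p ∨ y p = g p + z) := by
  set f : V → Letter := Pi.single p z with hf
  have fp : f p = z := Pi.single_eq_same _ _
  have fne : ∀ u, u ≠ p → f u = 0 := fun u hu => Pi.single_eq_of_ne hu _
  have f0 : f ≠ 0 := fun h => hz (by rw [← fp, h]; rfl)
  have hmem := hL.mem_sup_of_orthogonal (W := Submodule.span (ZMod 2) {f}) (N := N) (g := g)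
    ((Submodule.eq_bot_iff _).2 fun c hc => hP.eq_zero hn hc.1 (Z := {p}) (by simp) (by
      obtain ⟨r, rfl⟩ := Submodule.mem_span_singleton.1 hc.2
      intro u hu
      rw [Pi.smul_apply, fne u (by simpa using hu), smul_zero])) hNL (fun c hc d hd => by
      obtain ⟨r, rfl⟩ := Submodule.mem_span_singleton.1 hc
      simp [hf, form_single, hNp d hd]) hg (by rw [finrank_span_singleton f0]; exact h)
  obtain ⟨y, hy, c, hc, rfl⟩ := Submodule.mem_sup.1 hmem
  obtain ⟨r, rfl⟩ := Submodule.mem_span_singleton.1 hc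
  refine ⟨y, hy, fun u hu => by rw [Pi.add_apply, Pi.smul_apply, fne u hu, smul_zero, add_zero], ?_⟩
  rw [Pi.add_apply, Pi.smul_apply, fp]
  have hr : ∀ r : ZMod 2, r = 0 ∨ r = 1 := by decide
  rcases hr r with rfl | rfl
  · left; simp
  · right; rw [one_smul, add_assoc, add_self_letter, add_zero]

/-! ### Words of weight three -/

/-- Vanishing at one element imposes two linear conditions on the `n`-dimensional space `L`. -/
theorem IsSelfDual.card_le_finrank_supp_add (hL : IsSelfDual L) (Z : Finset V) :
    Fintype.card V ≤ finrank (ZMod 2) ↥(L ⊓ supp Z) + 2 * Zᶜ.card := by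
  let f : L →ₗ[ZMod 2] (↥(Zᶜ) → Letter) :=
    (LinearMap.funLeft (ZMod 2) Letter (Subtype.val : ↥(Zᶜ) → V)).domRestrict L
  have h := f.finrank_range_add_finrank_ker
  rw [hL.finrank_eq] at h
  have h1 := Submodule.finrank_le (LinearMap.range f)
  rw [finrank_words, Fintype.card_coe] at h1
  have h2 : finrank (ZMod 2) (LinearMap.ker f) ≤ finrank (ZMod 2) ↥(L ⊓ supp Z) := by
    rw [← Submodule.finrank_map_subtype_eq L (LinearMap.ker f)]
    apply Submodule.finrank_mono
    rintro _ ⟨c, hc, rfl⟩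
    refine ⟨c.2, fun u hu => ?_⟩
    exact congrFun (LinearMap.mem_ker.1 hc) ⟨u, Finset.mem_compl.2 hu⟩
  omega

/-- The words `t` whose nonzero letters are precisely those at `a`, `b`, `c`. -/
def HasSupp (t : V → Letter) (a b c : V) : Prop := ∀ u, t u ≠ 0 ↔ u = a ∨ u = b ∨ u = c

theorem HasSupp.fst {t : V → Letter} {a b c : V} (h : HasSupp t a b c) : t a ≠ 0 :=
  (h a).2 (Or.inl rfl)

theorem HasSupp.snd {t : V → Letter} {a b c : V} (h : HasSupp t a b c) : t b ≠ 0 :=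
  (h b).2 (Or.inr (Or.inl rfl))

theorem HasSupp.trd {t : V → Letter} {a b c : V} (h : HasSupp t a b c) : t c ≠ 0 :=
  (h c).2 (Or.inr (Or.inr rfl))

theorem HasSupp.eq_zero {t : V → Letter} {a b c u : V} (h : HasSupp t a b c) (ha : u ≠ a)
    (hb : u ≠ b) (hc : u ≠ c) : t u = 0 := by
  by_contra h0
  rcases (h u).1 h0 with h | h | h <;> contradiction

theorem HasSupp.mem_supp {t : V → Letter} {a b c : V} (h : HasSupp t a b c) {Z : Finset V}
    (ha : a ∈ Z) (hb : b ∈ Z) (hc : c ∈ Z) : t ∈ supp Z := fun _ hu =>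
  h.eq_zero (fun e => hu (e ▸ ha)) (fun e => hu (e ▸ hb)) (fun e => hu (e ▸ hc))

theorem HasSupp.swap {t : V → Letter} {a b c : V} (h : HasSupp t a b c) : HasSupp t b a c :=
  fun u => (h u).trans (by tauto)

theorem HasSupp.rotate {t : V → Letter} {a b c : V} (h : HasSupp t a b c) : HasSupp t b c a :=
  fun u => (h u).trans (by tauto)

/-- The supports meet only in `a`, so isotropy forces equal letters there. -/
theorem HasSupp.agree (hL : IsSelfDual L) {t t' : V → Letter} {a b c d e : V} (ht : t ∈ L)
    (ht' : t' ∈ L) (h : HasSupp t a b c) (h' : HasSupp t' a d e) (bd : b ≠ d) (be : b ≠ e)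
    (cd : c ≠ d) (ce : c ≠ e) : t a = t' a := by
  refine eq_of_pr h.fst h'.fst (hL.pr_eq_zero ht ht' fun u hu => ?_)
  by_cases hb : u = b
  · right; exact h'.eq_zero hu (hb ▸ bd) (hb ▸ be)
  by_cases hc : u = c
  · right; exact h'.eq_zero hu (hc ▸ cd) (hc ▸ ce)
  · left; exact h.eq_zero hu hb hc

/-- By isotropy the words agree at both common elements or at neither. If at both, their sum would
be a nonzero word of weight at most two. -/
theorem HasSupp.differ (hL : IsSelfDual L) (hP : IsPrime L) (hn : 4 ≤ Fintype.card V)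
    {t t' : V → Letter} {a b c d : V} (ht : t ∈ L) (ht' : t' ∈ L) (h : HasSupp t a b c)
    (h' : HasSupp t' a b d) (ab : a ≠ b) (ac : a ≠ c) (bc : b ≠ c) (cd : c ≠ d) :
    pr (t a) (t' a) = 1 ∧ pr (t b) (t' b) = 1 := by
  have heq : pr (t a) (t' a) = pr (t b) (t' b) := by
    refine hL.pr_eq_pr ht ht' ab fun u h1 h2 => ?_
    by_cases hc : u = c
    · right; exact h'.eq_zero h1 h2 (hc ▸ cd)
    · left; exact h.eq_zero h1 h2 hc
  rw [← heq, and_self, ← pr_ne_zero_iff]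
  intro h0
  have ea := eq_of_pr h.fst h'.fst h0
  have eb := eq_of_pr h.snd h'.snd (heq ▸ h0)
  have := hP.eq_zero hn (L.add_mem ht ht') (Z := {c, d}) Finset.card_le_two (fun u hu => by
    simp only [Finset.mem_insert, Finset.mem_singleton, not_or] at hu
    by_cases ha : u = a
    · rw [ha, Pi.add_apply, ea, add_self_letter]
    by_cases hb : u = b
    · rw [hb, Pi.add_apply, eb, add_self_letter]
    · rw [Pi.add_apply, h.eq_zero ha hb hu.1, h'.eq_zero ha hb hu.2, add_zero])
  have hc := congrFun this c
  rw [Pi.add_apply, h'.eq_zero (Ne.symm ac) (Ne.symm bc) cd, add_zero] at hc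
  exact h.trd hc

/-- The split has sides `{b, c}` and the rest. The word `t` provides the dimension on the first
side. A word avoiding `b` and `c` meets `t` only at `a`, so its letter there is `0` or `t a`; these
words form a space of dimension at least `n - 4`, one less than the size of the second side. -/
theorem HasSupp.bad (hL : IsSelfDual L) (hn : 5 ≤ Fintype.card V) {t : V → Letter} {a b c : V}
    (ht : t ∈ L) (h : HasSupp t a b c) (ab : a ≠ b) (ac : a ≠ c) (bc : b ≠ c) :
    Bad L a (t a) := by
  have hc3 : ({a, b, c} : Finset V).card = 3 := Finset.card_eq_three.2 ⟨a, b, c, ab, ac, bc, rfl⟩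
  have hcY : ({a, b, c} : Finset V)ᶜ.card + 3 = Fintype.card V := by
    rw [← hc3]; rw [Finset.card_compl_add_card]
  refine ⟨{b, c}, {a, b, c}ᶜ, ?_, ?_, (Finset.card_pair bc).ge, by omega, ?_, ?_⟩
  · rw [Finset.disjoint_left]; intro u; simp only [Finset.mem_compl, Finset.mem_insert]; tauto
  · ext u
    simp only [Finset.mem_union, Finset.mem_compl, Finset.mem_insert, Finset.mem_singleton]
    by_cases hb : u = b
    · simp [hb, Ne.symm ab]
    by_cases hc : u = c
    · simp [hc, Ne.symm ac]
    · simp [hb, hc]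
  · rw [Finset.card_pair bc]
    have := finrank_add_one_le (N := ⊥) (M := L ⊓ supp (insert a {b, c}) ⊓ letterAt a (t a))
      (t := t) bot_le ⟨⟨ht, h.mem_supp (by simp) (by simp) (by simp)⟩, pr_self _⟩ (fun h0 => by
        rw [Submodule.mem_bot] at h0
        exact h.fst (by rw [h0]; rfl))
    rw [finrank_bot] at this
    omega
  · have e : insert a ({a, b, c} : Finset V)ᶜ = {b, c}ᶜ := by
      ext u
      simp only [Finset.mem_compl, Finset.mem_insert, Finset.mem_singleton]
      by_cases ha : u = a
      · simp [ha, ab, ac]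
      · simp [ha]
    have hle : L ⊓ supp {b, c}ᶜ ≤ L ⊓ supp {b, c}ᶜ ⊓ letterAt a (t a) := by
      rintro d ⟨hd, hs⟩
      refine ⟨⟨hd, hs⟩, hL.pr_eq_zero ht hd fun u hu => ?_⟩
      by_cases hb : u = b
      · right; exact hs u (by simp [hb])
      by_cases hc : u = c
      · right; exact hs u (by simp [hc])
      · left; exact h.eq_zero hu hb hc
    rw [e]
    have h1 := Submodule.finrank_mono hle
    have h2 := hL.card_le_finrank_supp_add {b, c}ᶜ
    rw [compl_compl, Finset.card_pair bc] at h2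
    omega

/-! ### Chains of words of weight three -/

/-- A sequence of `k` distinct elements such that any three consecutive ones are the support of a
word of `N`. -/
structure IsChain (N : Submodule (ZMod 2) (V → Letter)) (k : ℕ) (v : ℕ → V) : Prop where
  inj : ∀ i j, i < k → j < k → v i = v j → i = j
  trip : ∀ i, i + 2 < k → Trip N (v i) (v (i + 1)) (v (i + 2))

theorem IsChain.ne {N : Submodule (ZMod 2) (V → Letter)} {k : ℕ} {v : ℕ → V} (h : IsChain N k v)
    {i j : ℕ} (hi : i < k) (hj : j < k) (hij : i ≠ j) : v i ≠ v j :=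
  fun e => hij (h.inj i j hi hj e)

theorem IsChain.mono {N : Submodule (ZMod 2) (V → Letter)} {k l : ℕ} {v : ℕ → V}
    (h : IsChain N k v) (hl : l ≤ k) : IsChain N l v :=
  ⟨fun i j hi hj => h.inj i j (by omega) (by omega), fun i hi => h.trip i (by omega)⟩

theorem IsChain.tail {N : Submodule (ZMod 2) (V → Letter)} {k : ℕ} {v : ℕ → V}
    (h : IsChain N (k + 1) v) : IsChain N k (fun i => v (i + 1)) :=
  ⟨fun i j hi hj e => by have := h.inj _ _ (by omega) (by omega) e; omega,
    fun i hi => h.trip (i + 1) (by omega)⟩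

theorem IsChain.reverse {N : Submodule (ZMod 2) (V → Letter)} {k : ℕ} {v : ℕ → V}
    (h : IsChain N k v) : IsChain N k (fun i => v (k - 1 - i)) := by
  refine ⟨fun i j hi hj e => by have := h.inj _ _ (by omega) (by omega) e; omega, fun i hi => ?_⟩
  refine (h.trip (k - 3 - i) (by omega)).perm fun u => ?_
  rw [show k - 3 - i + 1 = k - 1 - (i + 1) by omega, show k - 3 - i + 2 = k - 1 - i by omega,
    show k - 3 - i = k - 1 - (i + 2) by omega]
  tauto

theorem IsChain.cons {N : Submodule (ZMod 2) (V → Letter)} {k : ℕ} {v : ℕ → V} {w : V}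
    (h : IsChain N k v) (hw : ∀ i < k, w ≠ v i) (ht : Trip N w (v 0) (v 1)) :
    IsChain N (k + 1) (fun i => Nat.casesOn i w v) := by
  refine ⟨?_, ?_⟩
  · rintro (_ | i) (_ | j) hi hj e
    · rfl
    · exact absurd e (hw j (by omega))
    · exact absurd e.symm (hw i (by omega))
    · rw [h.inj i j (by omega) (by omega) e]
  · rintro (_ | i) hi
    · exact ht
    · exact h.trip i (by omega)

theorem IsChain.card_image {N : Submodule (ZMod 2) (V → Letter)} {k : ℕ} {v : ℕ → V}
    (h : IsChain N k v) : ((Finset.range k).image v).card = k := by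
  rw [Finset.card_image_of_injOn, Finset.card_range]
  intro i hi j hj e
  simp only [Finset.coe_range, Set.mem_Iio] at hi hj
  exact h.inj i j hi hj e

theorem image_range_succ (v : ℕ → V) (k : ℕ) :
    (Finset.range (k + 1)).image v = insert (v 0) ((Finset.range k).image fun i => v (i + 1)) := by
  ext u
  simp only [Finset.mem_image, Finset.mem_range, Finset.mem_insert]
  constructor
  · rintro ⟨_ | i, hi, rfl⟩
    · exact Or.inl rfl
    · exact Or.inr ⟨i, by omega, rfl⟩
  · rintro (rfl | ⟨i, hi, rfl⟩)
    · exact ⟨0, by omega, rfl⟩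
    · exact ⟨i + 1, by omega, rfl⟩

theorem IsChain.zero_notMem {N : Submodule (ZMod 2) (V → Letter)} {k : ℕ} {v : ℕ → V}
    (h : IsChain N (k + 1) v) : v 0 ∉ (Finset.range k).image fun i => v (i + 1) := by
  simp only [Finset.mem_image, Finset.mem_range, not_exists, not_and]
  intro i hi e
  have := h.inj _ _ (by omega) (by omega) e
  omega

theorem IsChain.mem_image {k i : ℕ} (v : ℕ → V) (hi : i < k) : v i ∈ (Finset.range k).image v :=
  Finset.mem_image_of_mem v (Finset.mem_range.2 hi)

/-- Each element but the last two starts a word vanishing at all earlier elements, so these `k - 2`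
words are independent. -/
theorem IsChain.le_finrank {N : Submodule (ZMod 2) (V → Letter)} {k : ℕ} {v : ℕ → V}
    (h : IsChain N k v) : k ≤ finrank (ZMod 2) ↥(N ⊓ supp ((Finset.range k).image v)) + 2 := by
  induction k generalizing v with
  | zero => omega
  | succ k ih =>
    by_cases hk : k + 1 ≤ 2
    · omega
    have h1 := ih h.tail
    obtain ⟨t, ht, hs⟩ := h.trip 0 (by omega)
    have hs : HasSupp t _ _ _ := hs
    have h2 := finrank_supp_insert_add_one h.zero_notMem ht (by
      rw [← image_range_succ]
      exact hs.mem_supp (IsChain.mem_image v (by omega)) (IsChain.mem_image v (by omega))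
        (IsChain.mem_image v (by omega))) hs.fst
    rw [image_range_succ]
    omega

/-- The tail contributes `k - 3` dimensions, and two words with distinct nonzero letters at the
first element contribute two more. -/
theorem IsChain.le_finrank_of_word {N : Submodule (ZMod 2) (V → Letter)} {k : ℕ} {v : ℕ → V}
    (h : IsChain N k v) (hk : 3 ≤ k) {t t' : V → Letter} (ht : t ∈ N) (ht' : t' ∈ N)
    (hs : t ∈ supp ((Finset.range k).image v)) (hs' : t' ∈ supp ((Finset.range k).image v))
    (hp : pr (t (v 0)) (t' (v 0)) = 1) :
    k ≤ finrank (ZMod 2) ↥(N ⊓ supp ((Finset.range k).image v)) + 1 := by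
  obtain ⟨k, rfl⟩ : ∃ l, k = l + 1 := ⟨k - 1, by omega⟩
  rw [image_range_succ] at *
  have h1 := h.tail.le_finrank
  have h2 := finrank_supp_insert_add_two h.zero_notMem ht ht' hs hs' hp
  omega

/-- Words realizing the consecutive triples of a chain. -/
theorem IsChain.exists_words {N : Submodule (ZMod 2) (V → Letter)} {k : ℕ} {v : ℕ → V}
    (h : IsChain N k v) : ∃ t : ℕ → V → Letter, ∀ i, i + 2 < k →
      t i ∈ N ∧ HasSupp (t i) (v i) (v (i + 1)) (v (i + 2)) := by
  choose! t ht using h.trip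
  exact ⟨t, ht⟩

/-- The first word of a chain of length at least four is crossed by another word of weight
three. -/
theorem IsChain.exists_crossing (hL : IsSelfDual L) (hP : IsPrime L) (hn : 6 ≤ Fintype.card V)
    {k : ℕ} {v : ℕ → V} (h : IsChain L k v) (hk : 4 ≤ k)
    (hbad : ∃ α β, pr α β = 1 ∧ Bad L (v 0) α ∧ Bad L (v 0) β) :
    ∃ w, w ≠ v 0 ∧ w ≠ v 1 ∧ w ≠ v 2 ∧ (Trip L (v 0) (v 1) w ∨ Trip L (v 0) (v 2) w) := by
  obtain ⟨t, ht⟩ := h.exists_words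
  obtain ⟨t0, s0⟩ := ht 0 (by omega)
  obtain ⟨t1, s1⟩ := ht 1 (by omega)
  have n01 : v 0 ≠ v 1 := h.ne (by omega) (by omega) (by omega)
  have n02 : v 0 ≠ v 2 := h.ne (by omega) (by omega) (by omega)
  have n12 : v 1 ≠ v 2 := h.ne (by omega) (by omega) (by omega)
  have n13 : v 1 ≠ v 3 := h.ne (by omega) (by omega) (by omega)
  have n23 : v 2 ≠ v 3 := h.ne (by omega) (by omega) (by omega)
  have n03 : v 0 ≠ v 3 := h.ne (by omega) (by omega) (by omega)
  -- Of two distinct nonzero letters at least one differs from the letter of `t 0`. At `v 1`, the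
  -- letter of `t 1` is bad by `HasSupp.bad` and differs from that of `t 0`, so the triangle lemma
  -- applies.
  obtain ⟨γ, hγ, hγb⟩ : ∃ γ, pr γ (t 0 (v 0)) = 1 ∧ Bad L (v 0) γ := by
    obtain ⟨α, β, hαβ, hα, hβ⟩ := hbad
    have key : ∀ α β s : Letter, pr α β = 1 → s ≠ 0 → pr α s = 1 ∨ pr β s = 1 := by decide
    rcases key α β _ hαβ s0.fst with h | h
    · exact ⟨α, h, hα⟩
    · exact ⟨β, h, hβ⟩
  have hd := (s1.differ hL hP (by omega) t1 t0 s0.rotate n12 n13 n23 (Ne.symm n03)).1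
  exact triangle_lemma hL hP hn n01 n02 n12 t0 s0 hγ hd hγb
    (s1.bad hL (by omega) t1 n12 n13 n23)

theorem mem_ker_form {g c : V → Letter} : c ∈ LinearMap.ker (form V g) ↔ form V g c = 0 :=
  LinearMap.mem_ker

/-! ### Closing a longest chain into a cycle -/

/-- A chain of `n` or `n - 1` elements that closes up at its first two elements closes up
completely. -/
theorem IsChain.closing (hL : IsSelfDual L) (hP : IsPrime L) (hn : 6 ≤ Fintype.card V)
    {k : ℕ} {v : ℕ → V} (h : IsChain L k v) (hk : Fintype.card V ≤ k + 1)
    (hT : Trip L (v 0) (v 1) (v (k - 1))) :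
    k = Fintype.card V ∧ Trip L (v (k - 2)) (v (k - 1)) (v 0) := by
  have hkn : k ≤ Fintype.card V := by rw [← h.card_image]; exact Finset.card_le_univ _
  obtain ⟨t, ht⟩ := h.exists_words
  obtain ⟨t', ht', s'⟩ := hT
  have s' : HasSupp t' _ _ _ := s'
  have ne : ∀ {i j : ℕ}, i < k → j < k → i ≠ j → v i ≠ v j := fun hi hj => h.ne hi hj
  have hR : ∀ {t : V → Letter} {i j l : ℕ}, HasSupp t (v i) (v j) (v l) → i < k → j < k → l < k →
      t ∈ supp ((Finset.range k).image v) := fun h hi hj hl =>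
    h.mem_supp (IsChain.mem_image v hi) (IsChain.mem_image v hj) (IsChain.mem_image v hl)
  obtain ⟨t0, s0⟩ := ht 0 (by omega)
  have d0 := s0.differ hL hP (by omega) t0 ht' s' (ne (by omega) (by omega) (by omega))
    (ne (by omega) (by omega) (by omega)) (ne (by omega) (by omega) (by omega))
    (ne (by omega) (by omega) (by omega))
  -- the common letter at the last element
  obtain ⟨m, rfl⟩ : ∃ m, k = m + 5 := ⟨k - 5, by omega⟩
  simp only [show m + 5 - 1 = m + 4 by omega, show m + 5 - 2 = m + 3 by omega] at *
  obtain ⟨tm2, sm2⟩ := ht (m + 2) (by omega)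
  simp only [show m + 2 + 1 = m + 3 by omega, show m + 2 + 2 = m + 4 by omega] at sm2
  have az : t (m + 2) (v (m + 4)) = t' (v (m + 4)) :=
    sm2.rotate.rotate.agree hL tm2 ht' s'.rotate.rotate (ne (by omega) (by omega) (by omega))
      (ne (by omega) (by omega) (by omega)) (ne (by omega) (by omega) (by omega))
      (ne (by omega) (by omega) (by omega))
  set z := t' (v (m + 4)) with hz
  have hz0 : z ≠ 0 := s'.trd
  have tz : ∀ i, i + 2 < m + 5 → pr z (t i (v (m + 4))) = 0 := fun i hi => by
    by_cases him : i = m + 2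
    · rw [him, az, pr_self]
    · rw [(ht i hi).2.eq_zero (ne (by omega) (by omega) (by omega))
        (ne (by omega) (by omega) (by omega)) (ne (by omega) (by omega) (by omega)),
        pr_zero_right]
  -- If one element `w` is missing, the chain words and `t'` give `n - 2` dimensions of words
  -- orthogonal to the single letter `z` at the last element. That letter then extends across `w` to
  -- a nonzero word of weight at most two, which is impossible.
  rcases Nat.lt_or_ge (m + 5) (Fintype.card V) with hlt | hge
  · exfalso
    obtain ⟨w, hw⟩ : ∃ w, w ∉ (Finset.range (m + 5)).image v := by
      by_contra hcon
      push Not at hcon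
      have := h.card_image
      rw [Finset.eq_univ_of_forall hcon, Finset.card_univ] at this
      omega
    have hwm : v (m + 4) ≠ w := fun e => hw (e ▸ IsChain.mem_image v (by omega))
    have hch : IsChain (L ⊓ letterAt (v (m + 4)) z) (m + 5) v := ⟨h.inj, fun i hi =>
      ⟨t i, ⟨(ht i hi).1, tz i hi⟩, (ht i hi).2⟩⟩
    have hrk := hch.le_finrank_of_word (by omega) ⟨t0, tz 0 (by omega)⟩ ⟨ht', pr_self z⟩
      (hR s0 (by omega) (by omega) (by omega)) (hR s' (by omega) (by omega) (by omega)) d0.1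
    obtain ⟨y, hy, hyg⟩ := hL.exists_extension hP (by omega) (w := w)
      (N := L ⊓ letterAt (v (m + 4)) z ⊓ supp ((Finset.range (m + 5)).image v))
      (g := Pi.single (v (m + 4)) z) (inf_le_left.trans inf_le_left) (fun c hc => hc.2 w hw)
      (fun c hc => by rw [form_single]; exact hc.1.2) (by omega)
    have hy0 := hP.eq_zero (by omega) hy (Z := {v (m + 4), w}) Finset.card_le_two fun u hu => by
      simp only [Finset.mem_insert, Finset.mem_singleton, not_or] at hu
      rw [hyg u hu.2, Pi.single_eq_of_ne hu.1]
    have := hyg _ hwm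
    rw [hy0, Pi.single_eq_same] at this
    exact hz0 this.symm
  · refine ⟨by omega, ?_⟩
    obtain ⟨tm1, sm1⟩ := ht (m + 1) (by omega)
    simp only [show m + 1 + 1 = m + 2 by omega, show m + 1 + 2 = m + 3 by omega] at sm1
    have dm : pr (t (m + 1) (v (m + 3))) (t (m + 2) (v (m + 3))) = 1 :=
      (sm1.rotate.differ hL hP (by omega) tm1 tm2 sm2 (ne (by omega) (by omega) (by omega))
        (ne (by omega) (by omega) (by omega)) (ne (by omega) (by omega) (by omega))
        (ne (by omega) (by omega) (by omega))).2
    obtain ⟨x, hx⟩ : ∃ x, pr x z = 1 := by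
      have : ∀ z : Letter, z ≠ 0 → ∃ x, pr x z = 1 := by decide
      exact this z hz0
    obtain ⟨hx0, -, hxz⟩ := pr_eq_one_iff.1 hx
    -- The letters of `g` make it orthogonal to every chain word and to `t'`: the first and last
    -- agree with `t (m + 1)` and `t 0`, while `x` contributes 1 against `z`, cancelling the 1 from
    -- `t'` at `v 0` and the 1 from `t (m + 2)` at `v (m + 3)`. Correcting the letter at `v (m + 4)`
    -- then puts `g` in `L`.
    set g : V → Letter := Pi.single (v (m + 3)) (t (m + 1) (v (m + 3))) +
      Pi.single (v (m + 4)) x + Pi.single (v 0) (t 0 (v 0)) with hg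
    have hgf : ∀ c, form V g c = pr (t (m + 1) (v (m + 3))) (c (v (m + 3))) + pr x (c (v (m + 4))) +
        pr (t 0 (v 0)) (c (v 0)) := fun c => by
      rw [hg, map_add, map_add, LinearMap.add_apply, LinearMap.add_apply, form_single, form_single,
        form_single]
    have gt' : form V g t' = 0 := by
      rw [hgf, s'.eq_zero (ne (by omega) (by omega) (by omega))
        (ne (by omega) (by omega) (by omega)) (ne (by omega) (by omega) (by omega)), ← hz, hx, d0.1,
        pr_zero_right, zero_add]
      rfl
    have gt : ∀ i, i + 2 < m + 5 → form V g (t i) = 0 := fun i hi => by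
      have hs := (ht i hi).2
      rw [hgf]
      have hend : pr (t 0 (v 0)) (t i (v 0)) = 0 := by
        by_cases hi0 : i = 0
        · rw [hi0, pr_self]
        · rw [hs.eq_zero (ne (by omega) (by omega) (by omega))
            (ne (by omega) (by omega) (by omega)) (ne (by omega) (by omega) (by omega)),
            pr_zero_right]
      rw [hend, add_zero]
      by_cases hi2 : i = m + 2
      · rw [hi2, dm, az, hx]; rfl
      rw [hs.eq_zero (u := v (m + 4)) (ne (by omega) (by omega) (by omega))
        (ne (by omega) (by omega) (by omega)) (ne (by omega) (by omega) (by omega)),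
        pr_zero_right, add_zero]
      by_cases hi1 : i = m + 1
      · rw [hi1, pr_self]
      · rw [hs.eq_zero (ne (by omega) (by omega) (by omega))
          (ne (by omega) (by omega) (by omega)) (ne (by omega) (by omega) (by omega)),
          pr_zero_right]
    have hch : IsChain (L ⊓ letterAt (v (m + 4)) z ⊓ LinearMap.ker (form V g)) (m + 5) v :=
      ⟨h.inj, fun i hi => ⟨t i, ⟨⟨(ht i hi).1, tz i hi⟩, mem_ker_form.2 (gt i hi)⟩, (ht i hi).2⟩⟩
    have hrk := hch.le_finrank_of_word (by omega) (t := t 0) (t' := t')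
      ⟨⟨t0, tz 0 (by omega)⟩, mem_ker_form.2 (gt 0 (by omega))⟩
      ⟨⟨ht', pr_self z⟩, mem_ker_form.2 gt'⟩
      (hR s0 (by omega) (by omega) (by omega)) (hR s' (by omega) (by omega) (by omega)) d0.1
    obtain ⟨y, hy, hyg, hyp⟩ := hL.exists_correction hP (by omega) (p := v (m + 4)) hz0
      (N := L ⊓ letterAt (v (m + 4)) z ⊓ LinearMap.ker (form V g) ⊓
        supp ((Finset.range (m + 5)).image v)) (g := g)
      (inf_le_left.trans (inf_le_left.trans inf_le_left)) (fun c hc => hc.1.1.2)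
      (fun c hc => mem_ker_form.1 hc.1.2) (by omega)
    have n34 : v (m + 3) ≠ v (m + 4) := ne (by omega) (by omega) (by omega)
    have n30 : v (m + 3) ≠ v 0 := ne (by omega) (by omega) (by omega)
    refine hP.trip (by omega) hy (fun h0 => ?_) (fun u hu => ?_)
    · have := hyg _ n34
      rw [h0, hg, Pi.add_apply, Pi.add_apply, Pi.single_eq_same, Pi.single_eq_of_ne n34,
        Pi.single_eq_of_ne n30, add_zero, add_zero] at this
      exact sm1.trd this.symm
    · simp only [Finset.mem_insert, Finset.mem_singleton, not_or] at hu
      rw [hyg u hu.2.1, hg, Pi.add_apply, Pi.add_apply, Pi.single_eq_of_ne hu.1,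
        Pi.single_eq_of_ne hu.2.1, Pi.single_eq_of_ne hu.2.2, add_zero, add_zero]

/-- The sequence `a, b, c, d, d, …`. -/
def fourSeq (a b c d : V) : ℕ → V
  | 0 => a
  | 1 => b
  | 2 => c
  | _ => d

theorem isChain_fourSeq {a b c d : V} (ab : a ≠ b) (ac : a ≠ c) (ad : a ≠ d) (bc : b ≠ c)
    (bd : b ≠ d) (cd : c ≠ d) (h : Trip L a b c) (h' : Trip L b c d) :
    IsChain L 4 (fourSeq a b c d) := by
  refine ⟨?_, ?_⟩
  · rintro (_ | _ | _ | _ | i) (_ | _ | _ | _ | j) hi hj e <;>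
      first | rfl | omega | (simp only [fourSeq] at e; first | exact absurd e ‹_› | exact absurd e.symm ‹_›)
  · rintro (_ | _ | i) hi
    · exact h
    · exact h'
    · omega

/-- At most one element, `x`, fails to be essential. -/
def EssentialExcept (L : Submodule (ZMod 2) (V → Letter)) (x : V) : Prop :=
  ∀ v, v ≠ x → ∃ α β, pr α β = 1 ∧ Bad L v α ∧ Bad L v β

theorem EssentialExcept.exists_isChain_four (hL : IsSelfDual L) (hP : IsPrime L)
    (hn : 6 ≤ Fintype.card V) {x : V} (hx : EssentialExcept L x) : ∃ v, IsChain L 4 v := by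
  obtain ⟨a, ha⟩ : ∃ a, a ≠ x := by
    have : Nontrivial V := Fintype.one_lt_card_iff_nontrivial.1 (by omega)
    exact exists_ne x
  obtain ⟨α, β, hαβ, hα, hβ⟩ := hx a ha
  obtain ⟨b, c, ba, ca, bc, hT⟩ := exists_trip_of_bad hP (by omega) hαβ hα hβ
  obtain ⟨b, c, ba, ca, bc, hb, t, ht, hs⟩ : ∃ b c, b ≠ a ∧ c ≠ a ∧ b ≠ c ∧ b ≠ x ∧ Trip L a b c := by
    by_cases hb : b = x
    · exact ⟨c, b, ca, ba, bc.symm, fun h => bc (hb.trans h.symm), hT.perm fun u => by tauto⟩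
    · exact ⟨b, c, ba, ca, bc, hb, hT⟩
  have hs : HasSupp t a b c := hs
  have key : ∀ u, u ≠ x → t u ≠ 0 → ∃ γ, pr γ (t u) = 1 ∧ Bad L u γ := by
    intro u hu h0
    obtain ⟨α, β, hαβ, hα, hβ⟩ := hx u hu
    have key : ∀ α β s : Letter, pr α β = 1 → s ≠ 0 → pr α s = 1 ∨ pr β s = 1 := by decide
    rcases key α β _ hαβ h0 with h | h
    · exact ⟨α, h, hα⟩
    · exact ⟨β, h, hβ⟩
  obtain ⟨γ, hγ, hγb⟩ := key a ha hs.fst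
  obtain ⟨δ, hδ, hδb⟩ := key b hb hs.snd
  -- The new word shares two elements with `t`; placing these in the middle yields the chain `c, a,
  -- b, d` or `b, a, c, d`.
  obtain ⟨d, da, db, dc, hd | hd⟩ := triangle_lemma hL hP hn ba.symm ca.symm bc ht hs hγ hδ hγb hδb
  · exact ⟨_, isChain_fourSeq ca bc.symm dc.symm ba.symm da.symm db.symm
      ⟨t, ht, hs.rotate.rotate⟩ hd⟩
  · exact ⟨_, isChain_fourSeq ba bc db.symm ca.symm da.symm dc.symm ⟨t, ht, hs.swap⟩ hd⟩

/-- A maximal chain whose first element is essential covers everything and closes up. -/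
theorem IsChain.cyclic (hL : IsSelfDual L) (hP : IsPrime L) (hn : 6 ≤ Fintype.card V)
    {k : ℕ} {v : ℕ → V} (h : IsChain L k v) (hk : 4 ≤ k)
    (hbad : ∃ α β, pr α β = 1 ∧ Bad L (v 0) α ∧ Bad L (v 0) β)
    (hmax : ∀ v', ¬ IsChain L (k + 1) v') :
    k = Fintype.card V ∧ Trip L (v (k - 2)) (v (k - 1)) (v 0) ∧
      Trip L (v (k - 1)) (v 0) (v 1) := by
  have hkn : k ≤ Fintype.card V := by rw [← h.card_image]; exact Finset.card_le_univ _
  suffices hT : Fintype.card V ≤ k + 1 ∧ Trip L (v 0) (v 1) (v (k - 1)) by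
    have := h.closing hL hP hn hT.1 hT.2
    exact ⟨this.1, this.2, hT.2.perm fun u => by tauto⟩
  have ne : ∀ {i j : ℕ}, i < k → j < k → i ≠ j → v i ≠ v j := fun hi hj => h.ne hi hj
  obtain ⟨t, ht⟩ := h.exists_words
  obtain ⟨t0, s0⟩ := ht 0 (by omega)
  obtain ⟨t1, s1⟩ := ht 1 (by omega)
  simp only [zero_add] at s0
  simp only [show 1 + 1 = 2 by omega, show 1 + 2 = 3 by omega] at s1
  obtain ⟨w, w0, w1, w2, hw⟩ := h.exists_crossing hL hP hn hk hbad
  have n01 : v 0 ≠ v 1 := ne (by omega) (by omega) (by omega)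
  have n02 : v 0 ≠ v 2 := ne (by omega) (by omega) (by omega)
  have n12 : v 1 ≠ v 2 := ne (by omega) (by omega) (by omega)
  -- the first and third element lie in a common triple with an element `w` after the fifth
  have far : ∀ t' ∈ L, HasSupp t' (v 0) (v 2) w → 5 ≤ k → w ≠ v 3 → w ≠ v 4 → False := by
    intro t' ht' s' hk5 w3 w4
    obtain ⟨t2, s2⟩ := ht 2 (by omega)
    simp only [show 2 + 1 = 3 by omega, show 2 + 2 = 4 by omega] at s2
    -- `t 2` meets each of `t'` and `t 0` only in `v 2`, so these two agree there, although they
    -- share `v 0` and `v 2` and must differ at both.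
    have e1 := s2.agree hL t2 ht' s'.swap (ne (by omega) (by omega) (by omega)) w3.symm
      (ne (by omega) (by omega) (by omega)) w4.symm
    have e2 := s2.agree hL t2 t0 s0.rotate.rotate (ne (by omega) (by omega) (by omega))
      (ne (by omega) (by omega) (by omega)) (ne (by omega) (by omega) (by omega))
      (ne (by omega) (by omega) (by omega))
    have hd := (s0.swap.rotate.differ hL hP (by omega) t0 ht' s' n02 n01 n12.symm w1.symm).2
    rw [← e1, ← e2, pr_self] at hd
    exact zero_ne_one hd
  -- a triple within the first `l` elements
  have inside : ∀ t' ∈ L, pr (t 0 (v 0)) (t' (v 0)) = 1 → ∀ l, 3 ≤ l → l ≤ k →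
      t' ∈ supp ((Finset.range l).image v) → Fintype.card V ≤ l + 1 := by
    intro t' ht' hd l hl hlk hs'
    have hc := h.mono hlk
    have hr := hc.le_finrank_of_word hl t0 ht' (s0.mem_supp (IsChain.mem_image v (by omega))
      (IsChain.mem_image v (by omega)) (IsChain.mem_image v (by omega))) hs' hd
    -- Such a word raises the dimension on the first `l` elements to `l - 1`, so these have cut-rank
    -- at most 1 and at most one element lies outside.
    by_contra hcon
    have := hP ((Finset.range l).image v) (by rw [hc.card_image]; omega)
      (by rw [Finset.card_compl, hc.card_image]; omega)
    rw [hc.card_image] at this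
    omega
  by_cases hwv : ∃ j < k, w = v j
  · obtain ⟨j, hj, rfl⟩ := hwv
    have hj3 : 3 ≤ j := by
      by_contra hcon
      have : j = 0 ∨ j = 1 ∨ j = 2 := by omega
      rcases this with rfl | rfl | rfl <;> contradiction
    rcases hw with ⟨t', ht', s'⟩ | ⟨t', ht', s'⟩
    · have s' : HasSupp t' (v 0) (v 1) (v j) := s'
      have hd := (s0.differ hL hP (by omega) t0 ht' s' n01 n02 n12 w2.symm).1
      have hcard := inside t' ht' hd (j + 1) (by omega) (by omega)
        (s'.mem_supp (IsChain.mem_image v (by omega)) (IsChain.mem_image v (by omega))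
          (IsChain.mem_image v (by omega)))
      by_cases hjk : j = k - 1
      · subst hjk
        exact ⟨by omega, t', ht', s'⟩
      -- At an interior `v j`, two successive chain words meet `t'` only in `v j` and so agree
      -- there, yet they share two elements and must differ.
      · exfalso
        obtain ⟨i, rfl⟩ : ∃ i, j = i + 2 := ⟨j - 2, by omega⟩
        obtain ⟨ti, si⟩ := ht i (by omega)
        obtain ⟨ti', si'⟩ := ht (i + 1) (by omega)
        simp only [show i + 1 + 1 = i + 2 by omega, show i + 1 + 2 = i + 3 by omega] at si'
        have e1 := si.rotate.rotate.agree hL ti ht' s'.rotate.rotate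
          (ne (by omega) (by omega) (by omega)) (ne (by omega) (by omega) (by omega))
          (ne (by omega) (by omega) (by omega)) (ne (by omega) (by omega) (by omega))
        have e2 := si'.swap.agree hL ti' ht' s'.rotate.rotate
          (ne (by omega) (by omega) (by omega)) (ne (by omega) (by omega) (by omega))
          (ne (by omega) (by omega) (by omega)) (ne (by omega) (by omega) (by omega))
        have hd := (si.rotate.differ hL hP (by omega) ti ti' si'
          (ne (by omega) (by omega) (by omega)) (ne (by omega) (by omega) (by omega))
          (ne (by omega) (by omega) (by omega)) (ne (by omega) (by omega) (by omega))).2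
        rw [e1, e2, pr_self] at hd
        exact zero_ne_one hd
    · have s' : HasSupp t' (v 0) (v 2) (v j) := s'
      have hd := (s0.swap.rotate.differ hL hP (by omega) t0 ht' s' n02 n01 n12.symm w1.symm).1
      have hcard := inside t' ht' hd (j + 1) (by omega) (by omega)
        (s'.mem_supp (IsChain.mem_image v (by omega)) (IsChain.mem_image v (by omega))
          (IsChain.mem_image v (by omega)))
      have hj4 : j = 4 := by
        by_contra hj4
        exact far t' ht' s' (by omega) (ne (by omega) (by omega) (by omega))
          (ne (by omega) (by omega) hj4)
      subst hj4
      have hn6 : Fintype.card V = 6 := by omega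
      have hc := h.mono (l := 5) (by omega)
      obtain ⟨w, hwR⟩ : ∃ w, w ∉ (Finset.range 5).image v := by
        by_contra hcon
        push Not at hcon
        have := hc.card_image
        rw [Finset.eq_univ_of_forall hcon, Finset.card_univ] at this
        omega
      have hwi : ∀ i < 5, w ≠ v i := fun i hi e => hwR (e ▸ IsChain.mem_image v hi)
      -- six elements: the word with letters at `w` and the first two elements
      set g : V → Letter := Pi.single (v 0) (t' (v 0)) + Pi.single (v 1) (t 1 (v 1)) with hg
      have hgf : ∀ c, form V g c = pr (t' (v 0)) (c (v 0)) + pr (t 1 (v 1)) (c (v 1)) := fun c => by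
        rw [hg, map_add, LinearMap.add_apply, form_single, form_single]
      have d01 := (s0.rotate.differ hL hP (by omega) t0 t1 s1 n12 n01.symm n02.symm
        (ne (by omega) (by omega) (by omega))).1
      have g0 : form V g (t 0) = 0 := by
        rw [hgf, pr_comm, hd, pr_comm, d01]; rfl
      have g' : form V g t' = 0 := by
        rw [hgf, pr_self, s'.eq_zero n01.symm n12 (ne (by omega) (by omega) (by omega)),
          pr_zero_right, add_zero]
      have gt : ∀ i, i + 2 < 5 → form V g (t i) = 0 := by
        intro i hi
        by_cases hi0 : i = 0
        · rw [hi0, g0]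
        have hs := (ht i (by omega)).2
        rw [hgf, hs.eq_zero (u := v 0) (ne (by omega) (by omega) (by omega))
          (ne (by omega) (by omega) (by omega)) (ne (by omega) (by omega) (by omega)),
          pr_zero_right, zero_add]
        by_cases hi1 : i = 1
        · rw [hi1, pr_self]
        · rw [hs.eq_zero (ne (by omega) (by omega) (by omega))
            (ne (by omega) (by omega) (by omega)) (ne (by omega) (by omega) (by omega)),
            pr_zero_right]
      have hch : IsChain (L ⊓ LinearMap.ker (form V g)) 5 v := ⟨hc.inj, fun i hi =>
        ⟨t i, ⟨(ht i (by omega)).1, mem_ker_form.2 (gt i hi)⟩, (ht i (by omega)).2⟩⟩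
      have hrk := hch.le_finrank_of_word (by omega) (t := t 0) (t' := t')
        ⟨t0, mem_ker_form.2 g0⟩ ⟨ht', mem_ker_form.2 g'⟩
        (s0.mem_supp (IsChain.mem_image v (by omega))
          (IsChain.mem_image v (by omega)) (IsChain.mem_image v (by omega)))
        (s'.mem_supp (IsChain.mem_image v (by omega)) (IsChain.mem_image v (by omega))
          (IsChain.mem_image v (by omega))) hd
      obtain ⟨y, hy, hyg⟩ := hL.exists_extension hP (by omega) (w := w)
        (N := L ⊓ LinearMap.ker (form V g) ⊓ supp ((Finset.range 5).image v)) (g := g)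
        (inf_le_left.trans inf_le_left) (fun c hc => hc.2 w hwR)
        (fun c hc => mem_ker_form.1 hc.1.2) (by omega)
      have hyT : Trip L w (v 0) (v 1) := by
        refine hP.trip (by omega) hy (fun h0 => ?_) (fun u hu => ?_)
        · have := hyg _ (hwi 0 (by omega)).symm
          rw [h0, hg, Pi.add_apply, Pi.single_eq_same, Pi.single_eq_of_ne n01, add_zero] at this
          exact s'.fst this.symm
        · simp only [Finset.mem_insert, Finset.mem_singleton, not_or] at hu
          rw [hyg u hu.1, hg, Pi.add_apply, Pi.single_eq_of_ne hu.2.1, Pi.single_eq_of_ne hu.2.2,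
            add_zero]
      -- The sixth element either lies outside the chain, which it would prolong, or is the last
      -- element and closes the chain.
      by_cases hwk : ∀ i < k, w ≠ v i
      · exact absurd (h.cons hwk hyT) (hmax _)
      · push Not at hwk
        obtain ⟨i, hi, rfl⟩ := hwk
        have : i = k - 1 := by
          by_contra hne
          exact hwi i (by omega) rfl
        subst this
        exact ⟨by omega, hyT.perm fun u => by tauto⟩
  · exfalso
    push Not at hwv
    rcases hw with hw | ⟨t', ht', s'⟩
    · exact hmax _ (h.cons hwv (hw.perm fun u => by tauto))
    · have s' : HasSupp t' (v 0) (v 2) w := s'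
      by_cases hk5 : 5 ≤ k
      · exact far t' ht' s' hk5 (hwv 3 (by omega)) (hwv 4 (by omega))
      · obtain rfl : k = 4 := by omega
        have n03 : v 0 ≠ v 3 := ne (by omega) (by omega) (by omega)
        have n13 : v 1 ≠ v 3 := ne (by omega) (by omega) (by omega)
        have n23 : v 2 ≠ v 3 := ne (by omega) (by omega) (by omega)
        -- A chain of length four stays a chain when its two middle elements are exchanged; the
        -- reordered chain can be prolonged by `w`.
        have hc := isChain_fourSeq n02 n01 n03 n12.symm n23 n13
          ⟨t 0, t0, fun u => (s0 u).trans (by tauto)⟩ ⟨t 1, t1, s1.swap⟩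
        refine hmax _ (hc.cons (w := w) (fun i hi => ?_) ⟨t', ht', s'.rotate.rotate⟩)
        have : i = 0 ∨ i = 1 ∨ i = 2 ∨ i = 3 := by omega
        rcases this with rfl | rfl | rfl | rfl
        · exact w0
        · exact w2
        · exact w1
        · exact hwv 3 (by omega)

/-- A code of length `n` in which every triple of cyclically consecutive elements supports a
word. -/
def IsCyclic (L : Submodule (ZMod 2) (V → Letter)) : Prop :=
  ∃ v : ℕ → V, IsChain L (Fintype.card V) v ∧
    Trip L (v (Fintype.card V - 2)) (v (Fintype.card V - 1)) (v 0) ∧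
      Trip L (v (Fintype.card V - 1)) (v 0) (v 1)

/-- Here every triple supports a nonzero word: vanishing on the other two elements costs only four
of the five dimensions. -/
theorem isCyclic_of_card_eq_five (hL : IsSelfDual L) (hP : IsPrime L)
    (hn : Fintype.card V = 5) : IsCyclic L := by
  have key : ∀ a b c : V, a ≠ b → a ≠ c → b ≠ c → Trip L a b c := by
    intro a b c ab ac bc
    have hc3 : ({a, b, c} : Finset V).card = 3 := Finset.card_eq_three.2 ⟨a, b, c, ab, ac, bc, rfl⟩
    have h := hL.card_le_finrank_supp_add {a, b, c}
    rw [Finset.card_compl, hc3, hn] at h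
    exact hP.trip_of_finrank (by omega) (N := L ⊓ supp {a, b, c}) le_rfl (by omega)
  let e := (Fintype.equivFinOfCardEq hn).symm
  have he : ∀ i j : ℕ, i < 5 → j < 5 → e (Fin.ofNat 5 i) = e (Fin.ofNat 5 j) → i = j := by
    intro i j hi hj h
    have := congrArg Fin.val (e.injective h)
    simp only [Fin.val_ofNat] at this
    omega
  have hne : ∀ i j : ℕ, i < 5 → j < 5 → i ≠ j → e (Fin.ofNat 5 i) ≠ e (Fin.ofNat 5 j) :=
    fun i j hi hj hij h => hij (he i j hi hj h)
  rw [IsCyclic, hn]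
  refine ⟨fun i => e (Fin.ofNat 5 i), ⟨he, fun i hi => key _ _ _ ?_ ?_ ?_⟩, key _ _ _ ?_ ?_ ?_,
    key _ _ _ ?_ ?_ ?_⟩ <;> apply hne <;> omega

/-- A prime self-dual code all of whose elements but at most one are essential is cyclic. -/
theorem EssentialExcept.isCyclic (hL : IsSelfDual L) (hP : IsPrime L) (hn : 5 ≤ Fintype.card V)
    {x : V} (hx : EssentialExcept L x) : IsCyclic L := by
  rcases hn.eq_or_lt with hn | hn
  · exact isCyclic_of_card_eq_five hL hP hn.symm
  obtain ⟨k, hk, ⟨v, hv⟩, hmax⟩ : ∃ k, 4 ≤ k ∧ (∃ v, IsChain L k v) ∧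
      ∀ v, ¬ IsChain L (k + 1) v := by
    by_contra hcon
    push Not at hcon
    have : ∀ m, ∃ v, IsChain L (4 + m) v := by
      intro m
      induction m with
      | zero => exact hx.exists_isChain_four hL hP hn
      | succ m ih => exact hcon (4 + m) (by omega) ih
    obtain ⟨v, hv⟩ := this (Fintype.card V)
    have := hv.card_image
    have := Finset.card_le_univ ((Finset.range (4 + Fintype.card V)).image v)
    omega
  -- Reversing the chain if necessary makes its first element essential.
  obtain ⟨v, hv, hvx⟩ : ∃ v, IsChain L k v ∧ v 0 ≠ x := by
    by_cases h0 : v 0 = x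
    · refine ⟨_, hv.reverse, ?_⟩
      rw [← h0]
      exact hv.ne (by omega) (by omega) (by omega)
    · exact ⟨v, hv, h0⟩
  obtain ⟨rfl, h1, h2⟩ := hv.cyclic hL hP hn hk (hx _ hvx) hmax
  exact ⟨v, hv, h1, h2⟩

end Codes

/-! ### The code of a graph -/

section Graph

variable {V : Type*}

/-- The entries of the adjacency matrix over the field with two elements. -/
noncomputable def adjEntry (G : SimpleGraph V) (u w : V) : ZMod 2 :=
  open Classical in if G.Adj u w then 1 else 0

theorem adjEntry_eq_one {G : SimpleGraph V} {u w : V} : adjEntry G u w = 1 ↔ G.Adj u w := by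
  unfold adjEntry; split <;> simp_all

theorem adjEntry_eq_zero {G : SimpleGraph V} {u w : V} : adjEntry G u w = 0 ↔ ¬ G.Adj u w := by
  unfold adjEntry; split <;> simp_all

theorem adjEntry_comm (G : SimpleGraph V) (u w : V) : adjEntry G u w = adjEntry G w u := by
  unfold adjEntry; rw [G.adj_comm]

theorem adjEntry_self (G : SimpleGraph V) (u : V) : adjEntry G u u = 0 :=
  adjEntry_eq_zero.2 (G.irrefl)

theorem adjEntry_localCompl [DecidableEq V] (G : SimpleGraph V) (v u w : V) :
    adjEntry (G.localCompl v) u w =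
      adjEntry G u w + if u = w then 0 else adjEntry G v u * adjEntry G v w := by
  unfold adjEntry SimpleGraph.localCompl
  by_cases h : u = w
  · simp [h]
  · by_cases h1 : G.Adj u w <;> by_cases h2 : G.Adj v u <;> by_cases h3 : G.Adj v w <;>
      simp [h, h1, h2, h3, Xor, CharTwo.add_self_eq_zero]

variable [Fintype V]

/-- The isotropic system of a graph, spanned by the rows of the adjacency matrix over the
identity matrix. -/
def code (G : SimpleGraph V) : Submodule (ZMod 2) (V → Letter) where
  carrier := {c | ∀ u, (c u).2 = ∑ w, adjEntry G u w * (c w).1}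
  add_mem' := fun {c d} hc hd u => by
    simp only [Pi.add_apply, Prod.snd_add, Prod.fst_add, mul_add, Finset.sum_add_distrib, hc u, hd u]
  zero_mem' := fun u => by simp
  smul_mem' := fun r c hc u => by
    simp only [Pi.smul_apply, Prod.smul_snd, Prod.smul_fst, smul_eq_mul, hc u, Finset.mul_sum]
    exact Finset.sum_congr rfl fun _ _ => by ring

theorem mem_code {G : SimpleGraph V} {c : V → Letter} :
    c ∈ code G ↔ ∀ u, (c u).2 = ∑ w, adjEntry G u w * (c w).1 := Iff.rfl

variable [DecidableEq V]

/-- The generator of the code corresponding to a vertex. -/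
noncomputable def gen (G : SimpleGraph V) (v u : V) : Letter :=
  (if u = v then 1 else 0, adjEntry G v u)

theorem gen_mem (G : SimpleGraph V) (v : V) : gen G v ∈ code G := by
  intro u
  simp [gen, adjEntry_comm G u v]

theorem code_isSelfDual (G : SimpleGraph V) : IsSelfDual (code G) := by
  refine le_antisymm (fun c hc u => ?_) (fun c hc => ?_)
  · have h := LinearMap.BilinForm.mem_orthogonal_iff.1 hc _ (gen_mem G u)
    rw [form_apply] at h
    simp only [pr, gen, ite_mul, one_mul, zero_mul, Finset.sum_add_distrib, Finset.sum_ite_eq',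
      Finset.mem_univ, if_true] at h
    exact CharTwo.add_eq_zero.1 h
  · refine LinearMap.BilinForm.mem_orthogonal_iff.2 fun d hd => ?_
    rw [form_apply]
    simp only [pr, Finset.sum_add_distrib]
    rw [CharTwo.add_eq_zero]
    simp only [mem_code.1 hc, mem_code.1 hd, Finset.mul_sum, Finset.sum_mul]
    rw [Finset.sum_comm]
    refine Finset.sum_congr rfl fun u _ => Finset.sum_congr rfl fun w _ => ?_
    rw [adjEntry_comm]; ring

/-! ### Local complementation -/

/-- A transvection of the letters, for `a * b = 0`. -/
def twist (a b : ZMod 2) (l : Letter) : Letter := (l.1 + a * l.2, l.2 + b * l.1)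

theorem twist_twist {a b : ZMod 2} (h : a * b = 0) (l : Letter) : twist a b (twist a b l) = l := by
  revert a b l; decide

theorem pr_twist {a b : ZMod 2} (h : a * b = 0) (l m : Letter) :
    pr (twist a b l) (twist a b m) = pr l m := by
  revert a b l m; decide

theorem twist_zero (a b : ZMod 2) : twist a b 0 = 0 := by revert a b; decide

/-- The action of a local complementation on the letters at `u`. -/
noncomputable def letterMap (G : SimpleGraph V) (v u : V) (l : Letter) : Letter :=
  twist (if u = v then 1 else 0) (adjEntry G v u) l

theorem letterMap_aux (G : SimpleGraph V) (v u : V) :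
    (if u = v then 1 else 0) * adjEntry G v u = 0 := by
  by_cases h : u = v
  · rw [h, adjEntry_self, mul_zero]
  · rw [if_neg h, zero_mul]

theorem letterMap_letterMap (G : SimpleGraph V) (v u : V) (l : Letter) :
    letterMap G v u (letterMap G v u l) = l := twist_twist (letterMap_aux G v u) l

theorem pr_letterMap (G : SimpleGraph V) (v u : V) (l m : Letter) :
    pr (letterMap G v u l) (letterMap G v u m) = pr l m := pr_twist (letterMap_aux G v u) l m

/-- The action of a local complementation on words. -/
noncomputable def wordMap (G : SimpleGraph V) (v : V) : (V → Letter) ≃ₗ[ZMod 2] (V → Letter) :=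
  LinearEquiv.ofInvolutive
    { toFun := fun c u => letterMap G v u (c u)
      map_add' := fun c d => by
        funext u
        simp only [letterMap, twist, Pi.add_apply, Prod.fst_add, Prod.snd_add, Prod.mk_add_mk]
        ext <;> simp only <;> ring
      map_smul' := fun r c => by
        funext u
        simp only [letterMap, twist, Pi.smul_apply, Prod.smul_fst, Prod.smul_snd, Prod.smul_mk,
          smul_eq_mul, RingHom.id_apply]
        ext <;> simp only <;> ring }
    fun c => funext fun u => letterMap_letterMap G v u (c u)

theorem wordMap_apply (G : SimpleGraph V) (v : V) (c : V → Letter) (u : V) :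
    wordMap G v c u = letterMap G v u (c u) := rfl

theorem wordMap_wordMap (G : SimpleGraph V) (v : V) (c : V → Letter) :
    wordMap G v (wordMap G v c) = c := funext fun u => letterMap_letterMap G v u (c u)

theorem wordMap_mem {G : SimpleGraph V} (v : V) {c : V → Letter} (hc : c ∈ code G) :
    wordMap G v c ∈ code (G.localCompl v) := by
  intro u
  have hu := hc u
  have hv := hc v
  have e1 : ∀ w, (wordMap G v c w).1 = (c w).1 + (if w = v then 1 else 0) * (c w).2 := fun w => rfl
  have e2 : (wordMap G v c u).2 = (c u).2 + adjEntry G v u * (c u).1 := rfl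
  rw [e2]
  simp only [e1, adjEntry_localCompl]
  -- Local complementation adds the product of the two entries off the diagonal only, hence the
  -- subtracted term for `w = u`; the last term comes from the changed first component at `v`.
  have s1 : ∑ w, (adjEntry G u w + if u = w then 0 else adjEntry G v u * adjEntry G v w) *
      ((c w).1 + (if w = v then 1 else 0) * (c w).2) =
      ∑ w, adjEntry G u w * (c w).1 + adjEntry G v u * ∑ w, adjEntry G v w * (c w).1 -
        adjEntry G v u * adjEntry G v u * (c u).1 + adjEntry G u v * (c v).2 := by
    have h1 : ∀ w, (adjEntry G u w + if u = w then 0 else adjEntry G v u * adjEntry G v w) *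
        ((c w).1 + (if w = v then 1 else 0) * (c w).2) =
        adjEntry G u w * (c w).1 + adjEntry G v u * (adjEntry G v w * (c w).1) -
        (if u = w then adjEntry G v u * adjEntry G v u * (c u).1 else 0) +
        (if w = v then adjEntry G u v * (c v).2 else 0) := by
      intro w
      by_cases huw : u = w
      · subst huw
        by_cases huv : u = v
        · subst huv; simp [adjEntry_self]
        · simp [huv]; ring
      · by_cases hwv : w = v
        · subst hwv; simp [huw, adjEntry_self]; ring
        · simp [huw, hwv]; ring
    rw [Finset.sum_congr rfl fun w _ => h1 w, Finset.sum_add_distrib, Finset.sum_sub_distrib,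
      Finset.sum_add_distrib, ← Finset.mul_sum, Finset.sum_ite_eq, Finset.sum_ite_eq']
    simp
  rw [s1, ← hu, ← hv, adjEntry_comm G u v]
  generalize adjEntry G v u = a
  generalize (c u).1 = x
  generalize (c u).2 = y
  generalize (c v).2 = z
  revert a x y z
  decide

theorem map_wordMap_code (G : SimpleGraph V) (v : V) :
    (code G).map (wordMap G v).toLinearMap = code (G.localCompl v) := by
  apply Submodule.eq_of_le_of_finrank_eq
  · rintro _ ⟨c, hc, rfl⟩
    exact wordMap_mem v hc
  · rw [LinearEquiv.finrank_map_eq, (code_isSelfDual _).finrank_eq, (code_isSelfDual _).finrank_eq]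

theorem wordMap_mem_of_localCompl {G : SimpleGraph V} {v : V} {c : V → Letter}
    (hc : c ∈ code (G.localCompl v)) : wordMap G v c ∈ code G := by
  rw [← map_wordMap_code] at hc
  obtain ⟨d, hd, rfl⟩ := hc
  rw [LinearEquiv.coe_coe, wordMap_wordMap]
  exact hd

/-! ### Fundamental graphs -/

/-- `H` is the fundamental graph of the code of `G` with respect to the letters `a`. -/
def IsFundamental (G : SimpleGraph V) (a : V → Letter) (H : SimpleGraph V) : Prop :=
  ∀ v, ∃ b ∈ code G, pr (a v) (b v) = 1 ∧
    ∀ w, w ≠ v → (H.Adj v w → b w = a w) ∧ (¬ H.Adj v w → b w = 0)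

theorem IsFundamental.localCompl {G H : SimpleGraph V} {a : V → Letter} (h : IsFundamental G a H)
    (v : V) : IsFundamental (G.localCompl v) (fun u => letterMap G v u (a u)) H := by
  intro u
  obtain ⟨b, hb, h1, h2⟩ := h u
  refine ⟨wordMap G v b, wordMap_mem v hb, by rw [wordMap_apply, pr_letterMap, h1],
    fun w hw => ⟨fun hH => ?_, fun hH => ?_⟩⟩
  · rw [wordMap_apply, (h2 w hw).1 hH]
  · rw [wordMap_apply, (h2 w hw).2 hH, letterMap, twist_zero]

/-- With all letters `(0, 1)`, the word at `v` has first component 1 at `v` and 0 elsewhere, so its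
second components are row `v` of the adjacency matrix. -/
theorem IsFundamental.eq {G H : SimpleGraph V} {a : V → Letter} (h : IsFundamental G a H)
    (ha : ∀ v, a v = (0, 1)) : G = H := by
  ext v w
  by_cases hvw : v = w
  · subst hvw; simp
  obtain ⟨b, hb, h1, h2⟩ := h v
  have hbv : (b v).1 = 1 := by rw [ha] at h1; simpa [pr] using h1
  have hb0 : ∀ u, u ≠ v → (b u).1 = 0 := fun u hu => by
    by_cases hH : H.Adj v u
    · rw [(h2 u hu).1 hH, ha]
    · rw [(h2 u hu).2 hH]; rfl
  have hw := hb w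
  rw [Finset.sum_eq_single v (fun u _ hu => by rw [hb0 u hu, mul_zero]) (by simp), hbv,
    mul_one] at hw
  by_cases hH : H.Adj v w
  · rw [(h2 w (Ne.symm hvw)).1 hH, ha] at hw
    simp only [hH, iff_true]
    exact (adjEntry_eq_one.1 hw.symm).symm
  · rw [(h2 w (Ne.symm hvw)).2 hH] at hw
    simp only [hH, iff_false]
    exact fun hG => adjEntry_eq_zero.1 hw.symm hG.symm

theorem letterMap_of_eq (G : SimpleGraph V) (v u : V) : letterMap G v u (0, 1) = (0, 1) ∨ u = v := by
  by_cases h : u = v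
  · exact Or.inr h
  · left; simp [letterMap, twist, h]

/-- A graph is locally equivalent to all fundamental graphs of its code. -/
theorem IsFundamental.locallyEquivalent {G H : SimpleGraph V} {a : V → Letter}
    (h : IsFundamental G a H) : G.LocallyEquivalent H := by
  obtain ⟨m, hm⟩ : ∃ m, (Finset.univ.filter fun v => a v ≠ (0, 1)).card ≤ m := ⟨_, le_rfl⟩
  induction m generalizing G a with
  | zero =>
    rw [Nat.le_zero, Finset.card_eq_zero, Finset.filter_eq_empty_iff] at hm
    rw [h.eq fun v => not_not.1 (hm (Finset.mem_univ v))]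
    exact Relation.ReflTransGen.refl
  | succ m ih =>
    have step : ∀ (G : SimpleGraph V) (a : V → Letter) (v : V), IsFundamental G a H →
        (Finset.univ.filter fun v => a v ≠ (0, 1)).card ≤ m + 1 → a v = (1, 1) →
        G.LocallyEquivalent H := by
      intro G a v h hm hv
      -- Complementing at `v` turns `(1, 1)` there into `(0, 1)` and leaves every `(0, 1)` elsewhere
      -- intact, so the number of wrong letters drops.
      refine Relation.ReflTransGen.head ⟨v, rfl⟩ (ih (h.localCompl v) ?_)
      rw [← Nat.lt_succ_iff]
      refine lt_of_lt_of_le (Finset.card_lt_card ?_) hm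
      rw [Finset.ssubset_iff_of_subset]
      · refine ⟨v, by simp [hv], ?_⟩
        simp [hv, letterMap, twist, adjEntry_self, CharTwo.add_self_eq_zero]
      · intro u
        simp only [Finset.mem_filter, Finset.mem_univ, true_and]
        intro hu hau
        rw [hau] at hu
        rcases letterMap_of_eq G v u with h | h
        · exact hu h
        · rw [h, hv] at hau
          exact absurd hau (by decide)
    have hletter : ∀ l : Letter, l ≠ 0 → l ≠ (0, 1) → l ≠ (1, 1) → l = (1, 0) := by decide
    have ha0 : ∀ v, a v ≠ 0 := fun v => by
      obtain ⟨b, -, h1, -⟩ := h v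
      exact (pr_eq_one_iff.1 h1).1
    by_cases hY : ∃ v, a v = (1, 1)
    · obtain ⟨v, hv⟩ := hY
      exact step G a v h hm hv
    push Not at hY
    by_cases hZ : ∀ v, a v = (0, 1)
    · rw [h.eq hZ]; exact Relation.ReflTransGen.refl
    push Not at hZ
    obtain ⟨v, hv⟩ := hZ
    have hvX := hletter _ (ha0 v) hv (hY v)
    -- Without such a neighbour, `gen G v` would meet the fundamental word at `v` nontrivially in
    -- `v` alone, against isotropy. Complementing at `v` then turns the letter `(1, 0)` at `w` into
    -- `(1, 1)` without creating wrong letters.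
    obtain ⟨w, hw, hwa⟩ : ∃ w, G.Adj v w ∧ a w ≠ (0, 1) := by
      by_contra hcon
      push Not at hcon
      obtain ⟨b, hb, h1, h2⟩ := h v
      have h3 := (code_isSelfDual G).form_eq_zero (gen_mem G v) hb
      rw [form_eq_sum Finset.univ (by simp), Finset.sum_eq_single v] at h3
      · have : gen G v v = a v := by rw [hvX]; simp [gen, adjEntry_self]
        rw [this, h1] at h3
        exact one_ne_zero h3
      · intro u _ hu
        by_cases hG : G.Adj v u
        · have : gen G v u = a u := by rw [hcon u hG]; simp [gen, hu, adjEntry_eq_one.2 hG]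
          rw [this]
          by_cases hH : H.Adj v u
          · rw [(h2 u hu).1 hH, pr_self]
          · rw [(h2 u hu).2 hH, pr_zero_right]
        · have : gen G v u = 0 := by simp [gen, hu, adjEntry_eq_zero.2 hG]
          rw [this, pr_zero_left]
      · simp
    have hwX := hletter _ (ha0 w) hwa (hY w)
    refine Relation.ReflTransGen.head ⟨v, rfl⟩ (step _ _ w (h.localCompl v) ?_ ?_)
    · refine le_trans (Finset.card_le_card ?_) hm
      intro u
      simp only [Finset.mem_filter, Finset.mem_univ, true_and]
      intro hu hau
      rw [hau] at hu
      rcases letterMap_of_eq G v u with h | h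
      · exact hu h
      · exact hv (h ▸ hau)
    · simp [hwX, letterMap, twist, adjEntry_eq_one.2 hw, hw.ne']

/-! ### Cyclic codes -/

/-- The cyclic successor on `{0, …, n - 1}`. -/
def next (n i : ℕ) : ℕ := if i + 1 = n then 0 else i + 1

theorem next_lt {n i : ℕ} (h : i < n) : next n i < n := by unfold next; split <;> omega

theorem cycleGraph_adj_next {n i l : ℕ} (hn : 5 ≤ n) (hi : i < n) (hl : l < n) :
    (SimpleGraph.cycleGraph n).Adj ⟨next n i, next_lt hi⟩ ⟨l, hl⟩ ↔ l = i ∨ l = next n (next n i) := by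
  rw [SimpleGraph.cycleGraph_adj']
  have hv : ∀ a b : Fin n, ((a - b : Fin n) : ℕ) =
      if (b : ℕ) ≤ a then (a : ℕ) - b else n - b + a := by
    intro a b
    split
    · exact Fin.sub_val_of_le ‹_›
    · rw [Fin.val_sub]
      exact Nat.mod_eq_of_lt (by have := b.2; omega)
  rw [hv, hv]
  simp only [next]
  split_ifs <;> omega

theorem IsCyclic.locallyEquivalentToCycle {G : SimpleGraph V} (hP : IsPrime (code G))
    (hn : 5 ≤ Fintype.card V) (h : IsCyclic (code G)) : G.LocallyEquivalentToCycle := by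
  obtain ⟨v, hv, h1, h2⟩ := h
  have hL := code_isSelfDual G
  set n := Fintype.card V with hnV
  have trip : ∀ i < n, Trip (code G) (v i) (v (next n i)) (v (next n (next n i))) := by
    intro i hi
    by_cases hi2 : i + 2 < n
    · have := hv.trip i hi2
      rwa [next, if_neg (by omega), next, if_neg (by omega)]
    by_cases hi1 : i + 2 = n
    · rw [next, if_neg (by omega), next, if_pos (by omega)]
      rwa [← hi1, show i + 2 - 2 = i by omega, show i + 2 - 1 = i + 1 by omega] at h1
    · rw [next, if_pos (by omega), next, if_neg (by omega)]
      rwa [show n - 1 = i by omega] at h2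
  choose! t ht hs using trip
  have hs : ∀ i < n, HasSupp (t i) (v i) (v (next n i)) (v (next n (next n i))) := hs
  have ne : ∀ {i j : ℕ}, i < n → j < n → i ≠ j → v i ≠ v j := fun hi hj => hv.ne hi hj
  have hbij : Function.Bijective fun i : Fin n => v i := by
    rw [Fintype.bijective_iff_injective_and_card]
    exact ⟨fun i j e => Fin.ext (hv.inj _ _ i.2 j.2 e), by rw [Fintype.card_fin]⟩
  let e := Equiv.ofBijective _ hbij
  have he : ∀ (i : ℕ) (hi : i < n), e.symm (v i) = ⟨i, hi⟩ := fun i hi =>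
    e.symm_apply_eq.2 rfl
  refine ⟨(SimpleGraph.cycleGraph n).comap e.symm, ?_, n, by omega,
    ⟨SimpleGraph.Iso.comap e.symm _⟩⟩
  -- The reference letter at each element is that of the word starting there. The word centred at
  -- `u` differs from it at `u`. At the far end it meets the word starting there only in that
  -- element, because `n ≥ 5`, and so agrees with the reference letter.
  refine IsFundamental.locallyEquivalent (a := fun u => t (e.symm u) u) fun u => ?_
  -- the word centred at `u`
  obtain ⟨i, hi, rfl⟩ : ∃ i < n, v (next n i) = u := by
    obtain ⟨j, rfl⟩ := e.surjective u
    by_cases hj : (j : ℕ) = 0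
    · refine ⟨n - 1, by omega, ?_⟩
      rw [next, if_pos (by omega), ← hj]; rfl
    · refine ⟨j - 1, by omega, ?_⟩
      rw [next, if_neg (by omega), show (j : ℕ) - 1 + 1 = j by omega]; rfl
  have l1 := next_lt hi
  have l2 := next_lt l1
  have l3 := next_lt l2
  have l4 := next_lt l3
  have d : next n (next n (next n i)) ≠ i ∧ next n (next n (next n (next n i))) ≠ i ∧
      next n (next n (next n (next n i))) ≠ next n i ∧ next n (next n (next n i)) ≠ next n i ∧
      next n i ≠ i ∧ next n (next n i) ≠ i ∧ next n (next n i) ≠ next n i := by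
    unfold next; refine ⟨?_, ?_, ?_, ?_, ?_, ?_, ?_⟩ <;> split_ifs <;> omega
  obtain ⟨d1, d2, d3, d4, d5, d6, d7⟩ := d
  refine ⟨t i, ht i hi, ?_, fun w hw => ?_⟩
  · simp only [he _ l1]
    exact ((hs _ l1).differ hL hP (by omega) (ht _ l1) (ht i hi) (hs i hi).rotate
      (ne l1 l2 d7.symm) (ne l1 l3 d4.symm) (ne l2 l3 (by
        intro h; apply d7
        unfold next at h ⊢; split_ifs at h ⊢ <;> omega)) (ne l3 hi d1)).1
  · obtain ⟨⟨l, hl⟩, rfl⟩ := e.surjective w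
    have hel : e ⟨l, hl⟩ = v l := rfl
    simp only [SimpleGraph.comap_adj, hel, he _ l1, he _ hl, cycleGraph_adj_next hn hi hl]
    constructor
    · rintro (rfl | rfl)
      · rfl
      · exact (hs i hi).rotate.rotate.agree hL (ht i hi) (ht _ l2) (hs _ l2)
          (ne hi l3 d1.symm) (ne hi l4 d2.symm) (ne l1 l3 d4.symm) (ne l1 l4 d3.symm)
    · intro h
      push Not at h
      exact (hs i hi).eq_zero (ne hl hi h.1) hw (ne hl l2 h.2)

/-! ### Splits of graphs and of their codes -/

theorem code_eq_zero_of_fst {G : SimpleGraph V} {c : V → Letter} (hc : c ∈ code G)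
    (h : ∀ u, (c u).1 = 0) : c = 0 := by
  funext u
  ext
  · exact h u
  · rw [hc u]; simp [h]

/-- A word supported on `Z` is determined by its first components, which lie in the kernel of the
adjacency block between `Z` and its complement. Too many such words make the block of rank at most
one, and a rank-one block is exactly a split. -/
theorem code_isPrime {G : SimpleGraph V} (hG : G.IsPrimeGraph) : IsPrime (code G) := by
  intro Z hZ hZc
  by_contra hcon
  apply hG
  let M : Matrix ↥(Zᶜ) ↥Z (ZMod 2) := fun y z => adjEntry G y z
  let f : ↥(code G ⊓ supp Z) →ₗ[ZMod 2] (↥Z → ZMod 2) :=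
    { toFun := fun c z => (c.1 z).1
      map_add' := fun _ _ => rfl
      map_smul' := fun _ _ => rfl }
  have hf : ∀ c, f c ∈ LinearMap.ker M.mulVecLin := by
    rintro ⟨c, hc, hs⟩
    rw [LinearMap.mem_ker]
    funext ⟨y, hy⟩
    have h := hc y
    rw [hs y (Finset.mem_compl.1 hy)] at h
    rw [Matrix.mulVecLin_apply, Matrix.mulVec, dotProduct, Pi.zero_apply]
    refine Eq.trans (Finset.sum_attach Z fun z => adjEntry G y z * (c z).1) (Eq.trans ?_ h.symm)
    exact Finset.sum_subset (Finset.subset_univ _) fun u _ hu => by rw [hs u hu]; simp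
  have hinj : Function.Injective (f.codRestrict _ hf) := by
    rw [← LinearMap.ker_eq_bot, LinearMap.ker_codRestrict, Submodule.eq_bot_iff]
    rintro ⟨c, hc, hs⟩ h0
    refine Subtype.ext (code_eq_zero_of_fst hc fun u => ?_)
    by_cases hu : u ∈ Z
    · exact congrFun (LinearMap.mem_ker.1 h0) ⟨u, hu⟩
    · exact congrArg Prod.fst (hs u hu)
  have h1 := LinearMap.finrank_le_finrank_of_injective hinj
  have h2 := M.mulVecLin.finrank_range_add_finrank_ker
  rw [Module.finrank_fintype_fun_eq_card, Fintype.card_coe] at h2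
  obtain ⟨⟨x, _⟩, hx⟩ := finrank_le_one_iff.1
    (show finrank (ZMod 2) (LinearMap.range M.mulVecLin) ≤ 1 by omega)
  have hcol : ∀ z : ↥Z, ∃ r : ZMod 2, ∀ y : ↥(Zᶜ), adjEntry G y z = r * x y := by
    intro z
    obtain ⟨r, hr⟩ := hx ⟨M.mulVecLin (Pi.single z 1), LinearMap.mem_range_self _ _⟩
    refine ⟨r, fun y => ?_⟩
    have hcol : M.mulVecLin (Pi.single z 1) y = adjEntry G y z := by
      rw [Matrix.mulVecLin_apply, Matrix.mulVec_single_one]; rfl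
    rw [← hcol]
    exact (congrFun (congrArg Subtype.val hr) y).symm
  choose r hr using hcol
  refine ⟨Z, ↑(Zᶜ), by simp, ?_, Finset.one_lt_card_iff_nontrivial.1 hZ,
    Finset.one_lt_card_iff_nontrivial.1 hZc,
    {u | ∃ h : u ∈ Z, r ⟨u, h⟩ = 1}, fun u hu => hu.1, {u | ∃ h : u ∈ Zᶜ, x ⟨u, h⟩ = 1},
    fun u hu => hu.1, fun u hu w hw => ?_⟩
  · rw [Finset.coe_compl]; exact disjoint_compl_right
  · have h := hr ⟨u, hu⟩ ⟨w, hw⟩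
    have hmul : ∀ a b : ZMod 2, a * b = 1 ↔ a = 1 ∧ b = 1 := by decide
    rw [G.adj_comm, ← adjEntry_eq_one, h, hmul]
    exact ⟨fun h => ⟨⟨hu, h.1⟩, ⟨hw, h.2⟩⟩, fun h => ⟨h.1.2, h.2.2⟩⟩

/-- A word of the code of `G`, given by its first components. -/
noncomputable def encode (G : SimpleGraph V) : (V → ZMod 2) →ₗ[ZMod 2] (V → Letter) where
  toFun x u := (x u, ∑ w, adjEntry G u w * x w)
  map_add' x y := by
    funext u
    simp [mul_add, Finset.sum_add_distrib]
  map_smul' r x := by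
    funext u
    simp only [Pi.smul_apply, smul_eq_mul, RingHom.id_apply, Prod.smul_mk, Finset.mul_sum]
    congr 1
    exact Finset.sum_congr rfl fun _ _ => by ring

/-- First components supported on `X` whose sum over `X ∩ A` is zero encode words vanishing on `Y`.
This single condition leaves dimension at least `|X| - 1`, and the letter at `v` is `0` or `(0, 1)`.
-/
theorem halfBad_of_split {G : SimpleGraph V} {v : V} {X Y : Finset V} (hXY : X ∪ Y = {v}ᶜ)
    {A B : Set V} (h : ∀ x ∈ X, ∀ y ∈ Y, G.Adj x y ↔ x ∈ A ∧ y ∈ B) :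
    HalfBad (code G) v (0, 1) X := by
  classical
  have m := mem_of_partition hXY
  let φ : (↥X → ZMod 2) →ₗ[ZMod 2] ZMod 2 :=
    ∑ z : ↥X, (if (z : V) ∈ A then (1 : ZMod 2) else 0) • LinearMap.proj z
  let ext0 : (↥X → ZMod 2) →ₗ[ZMod 2] (V → ZMod 2) :=
    { toFun := fun x u => if hu : u ∈ X then x ⟨u, hu⟩ else 0
      map_add' := fun x y => by funext u; by_cases hu : u ∈ X <;> simp [hu]
      map_smul' := fun r x => by funext u; by_cases hu : u ∈ X <;> simp [hu] }
  have ext_in : ∀ x (z : ↥X), ext0 x z = x z := fun x z => by simp [ext0]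
  have ext_out : ∀ x u, u ∉ X → ext0 x u = 0 := fun x u hu => by simp [ext0, hu]
  have hinj : Function.Injective ((encode G).comp ext0) := fun x y hxy => by
    funext z
    have := congrArg Prod.fst (congrFun hxy z)
    change ext0 x z = ext0 y z at this
    rwa [ext_in, ext_in] at this
  have hle : (LinearMap.ker φ).map ((encode G).comp ext0) ≤
      code G ⊓ supp (insert v X) ⊓ letterAt v (0, 1) := by
    rintro _ ⟨x, hx, rfl⟩
    refine ⟨⟨fun u => rfl, fun u hu => ?_⟩, ?_⟩
    · rw [Finset.mem_insert, not_or] at hu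
      have huY : u ∈ Y := ((m u).2 hu.1).resolve_left hu.2
      have hx : φ x = 0 := hx
      refine Prod.ext (ext_out x u hu.2) ?_
      change ∑ w, adjEntry G u w * ext0 x w = 0
      have hsum : ∑ w, adjEntry G u w * ext0 x w = ∑ z : ↥X, adjEntry G u z * x z := by
        rw [Finset.univ_eq_attach, ← Finset.sum_subset (Finset.subset_univ X) fun w _ hw => by
          rw [ext_out x w hw, mul_zero], ← Finset.sum_attach]
        exact Finset.sum_congr rfl fun z _ => by rw [ext_in]
      have hentry : ∀ z : ↥X, adjEntry G u z =
          (if u ∈ B then 1 else 0) * (if (z : V) ∈ A then 1 else 0) := by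
        intro z
        have := h z z.2 u huY
        rw [G.adj_comm] at this
        by_cases hA : (z : V) ∈ A <;> by_cases hB : u ∈ B <;>
          simp [hA, hB, adjEntry, this]
      rw [hsum]
      simp only [hentry, mul_assoc]
      rw [← Finset.mul_sum]
      have : φ x = ∑ z : ↥X, (if (z : V) ∈ A then (1 : ZMod 2) else 0) * x z := by
        simp only [φ, LinearMap.sum_apply, LinearMap.smul_apply, LinearMap.proj_apply, smul_eq_mul]
      rw [← this, hx, mul_zero]
    · have hv : v ∉ X := fun hv => (m v).1 (Or.inl hv) rfl
      change pr (0, 1) (ext0 x v, _) = 0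
      rw [ext_out x v hv]
      simp [pr]
  have h1 := Submodule.finrank_mono hle
  rw [(Submodule.equivMapOfInjective _ hinj _).symm.finrank_eq] at h1
  have h2 := φ.finrank_range_add_finrank_ker
  have h3 := Submodule.finrank_le (LinearMap.range φ)
  rw [Module.finrank_self] at h3
  rw [Module.finrank_fintype_fun_eq_card, Fintype.card_coe] at h2
  unfold HalfBad
  omega

theorem bad_of_deleteVertex {G : SimpleGraph V} {v : V} (h : ¬ (G.deleteVertex v).IsPrimeGraph) :
    Bad (code G) v (0, 1) := by
  classical
  rw [SimpleGraph.IsPrimeGraph, not_not] at h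
  obtain ⟨A, B, hAB, hd, hA, hB, A', -, B', -, hadj⟩ := h
  have mem : ∀ (C : Set {u : V // u ≠ v}) (u : V),
      u ∈ C.toFinset.map (Function.Embedding.subtype _) ↔ ∃ h : u ≠ v, ⟨u, h⟩ ∈ C := by
    intro C u
    simp
  have hXY : A.toFinset.map (Function.Embedding.subtype _) ∪
      B.toFinset.map (Function.Embedding.subtype _) = {v}ᶜ := by
    ext u
    rw [Finset.mem_union, mem, mem, ← exists_or, Finset.mem_compl, Finset.mem_singleton]
    exact ⟨fun ⟨h, _⟩ => h, fun h => ⟨h, (Set.mem_union _ _ _).1 (hAB ▸ Set.mem_univ _)⟩⟩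
  have hYX := (Finset.union_comm _ _).trans hXY
  have hadj' : ∀ x ∈ A.toFinset.map (Function.Embedding.subtype _),
      ∀ y ∈ B.toFinset.map (Function.Embedding.subtype _),
        G.Adj x y ↔ x ∈ Subtype.val '' A' ∧ y ∈ Subtype.val '' B' := by
    intro x hx y hy
    obtain ⟨hxv, hx⟩ := (mem A x).1 hx
    obtain ⟨hyv, hy⟩ := (mem B y).1 hy
    have := hadj _ hx _ hy
    simp only [SimpleGraph.deleteVertex, SimpleGraph.comap_adj] at this
    rw [this]
    simp [hxv, hyv]
  have hcard : ∀ C : Set {u : V // u ≠ v}, C.Nontrivial →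
      2 ≤ (C.toFinset.map (Function.Embedding.subtype (fun u => u ≠ v))).card := by
    intro C hC
    rw [Finset.card_map]
    exact Finset.one_lt_card_iff_nontrivial.2 (by rwa [← Finset.nontrivial_coe, Set.coe_toFinset])
  refine ⟨_, _, ?_, hXY, hcard A hA, hcard B hB, halfBad_of_split hXY hadj',
    halfBad_of_split (A := Subtype.val '' B') (B := Subtype.val '' A') hYX fun x hx y hy => ?_⟩
  · rw [Finset.disjoint_left]
    intro u hu hu'
    obtain ⟨h, hu⟩ := (mem A u).1 hu
    obtain ⟨h', hu'⟩ := (mem B u).1 hu'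
    exact Set.disjoint_left.1 hd hu hu'
  · rw [G.adj_comm, hadj' y hy x hx, and_comm]

theorem HalfBad.of_localCompl {G : SimpleGraph V} {v a : V} {α : Letter} {X : Finset V}
    (h : HalfBad (code (G.localCompl v)) a α X) :
    HalfBad (code G) a (letterMap G v a α) X := by
  unfold HalfBad at *
  refine h.trans (Nat.add_le_add_right ?_ 1)
  rw [← LinearEquiv.finrank_map_eq (wordMap G v)]
  apply Submodule.finrank_mono
  rintro _ ⟨c, ⟨⟨hc, hs⟩, ha⟩, rfl⟩
  refine ⟨⟨wordMap_mem_of_localCompl hc, fun u hu => ?_⟩, ?_⟩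
  · change wordMap G v c u = 0
    rw [wordMap_apply, hs u hu, letterMap, twist_zero]
  · change pr (letterMap G v a α) (wordMap G v c a) = 0
    rw [wordMap_apply, pr_letterMap]
    exact ha

theorem Bad.of_localCompl {G : SimpleGraph V} {v a : V} {α : Letter}
    (h : Bad (code (G.localCompl v)) a α) : Bad (code G) a (letterMap G v a α) := by
  obtain ⟨X, Y, hd, hu, hX, hY, hbX, hbY⟩ := bad_iff.1 h
  exact bad_iff.2 ⟨X, Y, hd, hu, hX, hY, hbX.of_localCompl, hbY.of_localCompl⟩

/-- Pulled back through the three local complementations, the letter `(0, 1)` at `v` becomes `(1,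
1)`, then `(1, 0)`, and stays `(1, 0)`. -/
theorem Bad.of_pivoting {G : SimpleGraph V} {v w : V} (hvw : G.Adj v w)
    (h : Bad (code (G.pivoting v w)) v (0, 1)) : Bad (code G) v (1, 0) := by
  have h1 := h.of_localCompl.of_localCompl.of_localCompl
  have e1 : ∀ H : SimpleGraph V, letterMap H v v (0, 1) = (1, 1) := fun H => by
    simp [letterMap, twist, adjEntry_self]
  have e2 : letterMap (G.localCompl v) w v (1, 1) = (1, 0) := by
    have : adjEntry (G.localCompl v) w v = 1 := by
      rw [adjEntry_localCompl, if_neg hvw.ne', adjEntry_self, mul_zero, add_zero]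
      exact adjEntry_eq_one.2 hvw.symm
    simp [letterMap, twist, this, hvw.ne, CharTwo.add_self_eq_zero]
  have e3 : letterMap G v v (1, 0) = (1, 0) := by simp [letterMap, twist, adjEntry_self]
  rwa [e1, e2, e3] at h1

theorem bad_of_not_nonPivotal {G : SimpleGraph V} (hG : G.IsPrimeGraph)
    (hn : 4 ≤ Fintype.card V) {v : V} (h : ¬ G.NonPivotal v) :
    Bad (code G) v (0, 1) ∧ Bad (code G) v (1, 0) := by
  rw [SimpleGraph.NonPivotal, not_or] at h
  refine ⟨bad_of_deleteVertex h.1, ?_⟩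
  obtain ⟨-, h⟩ := h
  push Not at h
  obtain ⟨H, ⟨hiso, -⟩ | ⟨w, hw, rfl⟩, hH⟩ := h
  -- An isolated vertex would give a word of weight one.
  · exfalso
    have := (code_isPrime hG).eq_zero hn (gen_mem G v) (Z := {v}) (by simp) fun u hu => by
      simp only [Finset.mem_singleton] at hu
      simp [gen, hu, adjEntry_eq_zero.2 (hiso u)]
    have := congrArg Prod.fst (congrFun this v)
    simp [gen] at this
  · exact (bad_of_deleteVertex hH).of_pivoting hw

end Graph

end PauliCode

/-! ### The theorem -/

theorem corollary2 {V : Type*} [Fintype V] (G : SimpleGraph V)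
    (hcard : 5 ≤ Fintype.card V) (hprime : G.IsPrimeGraph)
    (hcycle : ¬ G.LocallyEquivalentToCycle) :
    2 ≤ {v : V | G.NonPivotal v}.ncard := by
  classical
  by_contra hcon
  -- If no vertex is non-pivotal, any vertex serves as the exception `x`.
  obtain ⟨x, hx⟩ : ∃ x, ∀ v, G.NonPivotal v → v = x := by
    have h1 : {v : V | G.NonPivotal v}.ncard ≤ 1 := by omega
    rw [Set.ncard_le_one] at h1
    by_cases hne : ∃ x, G.NonPivotal x
    · obtain ⟨x, hx⟩ := hne
      exact ⟨x, fun v hv => h1 v hv x hx⟩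
    · have : Nonempty V := Fintype.card_pos_iff.1 (by omega)
      exact ⟨Classical.arbitrary V, fun v hv => absurd ⟨v, hv⟩ hne⟩
  have hP := PauliCode.code_isPrime hprime
  have hess : PauliCode.EssentialExcept (PauliCode.code G) x := fun v hv => by
    have := PauliCode.bad_of_not_nonPivotal hprime (by omega) fun h => hv (hx v h)
    exact ⟨(0, 1), (1, 0), by decide, this.1, this.2⟩
  exact hcycle ((hess.isCyclic (PauliCode.code_isSelfDual G) hP hcard).locallyEquivalentToCycle
    hP hcard)
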